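/- Let $\mathbb{k}$ be an algebraically closed field and let $R=\bigoplus_{\gamma\in\mathbb{R}_{\ge 0}}R_\gamma$ be a finitely generated $\mathbb{R}_{\ge 0}$-graded $\mathbb{k}$-algebra with $R_0=\mathbb{k}$ which is a normal (that is, integrally closed) domain of Krull dimension $n\ge 1$. For a finitely generated $\mathbb{R}$-graded $R$-module $M=\bigoplus_{\lambda\in\mathbb{R}}M_\lambda$ put $M_{\le x}=\bigoplus_{\lambda\le x}M_\lambda$, let $\operatorname{rank}(M)$ be its rank over the domain $R$, and let $a_n(M),a_{n-1}(M)\in\mathbb{R}$ be the (unique, if they exist) constants such that $\dim_{\mathbb{k}}M_{\le x}<\infty$ for all $x$, \[ \dim_{\mathbb{k}} M_{\le x}=\frac{a_n(M)}{n!}x^n+O(x^{n-1})\quad(x\to\infty), \] \[ \lim_{T\to\infty}\frac1{T^n}\int_1^T\Bigl(\dim_{\mathbb{k}} M_{\le x}-\frac{a_n(M)}{n!}x^n-\frac{a_{n-1}(M)}{(n-1)!}x^{n-1}\Bigr)dx=0 . \] The degree of $M$ is $\deg(M)=a_{n-1}(M)-\operatorname{rank}(M)\,a_{n-1}(R)$.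 The dual $M^\vee=\operatorname{Hom}_R(M,R)$ is graded by letting $(M^\vee)_\lambda$ be the set of $R$-linear maps $f:M\to R$ with $f(M_t)\subset R_{\lambda+t}$ for all $t\in\mathbb{R}$. Then for every finitely generated torsion-free $\mathbb{R}$-graded $R$-module $M$, the constants $a_n,a_{n-1}$ exist for $R$, $M$ and $M^\vee$, and \[ \deg(M^\vee)=-\deg(M). \] -/

import Mathlib

open Filter Topology Asymptotics
open scoped Nat

noncomputable section

/-- The dimension over `k` of `M_{≤ x} = ⨁_{t ≤ x} M_t`, for a family `ℳ` of homogeneous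
components `M_t`, `t : ℝ`. -/
def dimLE {k M : Type*} [Field k] [AddCommGroup M] [Module k M]
    (ℳ : ℝ → Submodule k M) (x : ℝ) : ℕ :=
  Module.finrank k (⨆ (t : ℝ) (_ : t ≤ x), ℳ t : Submodule k M)

/-- `a` and `b` are the first two coefficients `a_n(M)` and `a_{n-1}(M)` of the averaged
asymptotic Riemann-Roch expansion (to be used with `1 ≤ n`):
* every `M_{≤ x}` is finite-dimensional over `k`;
* `dim M_{≤ x} = a / n! * x ^ n + O(x ^ (n - 1))` as `x → ∞`;
* `T ^ (-n) * ∫_1^T (dim M_{≤ x} - a / n! * x ^ n - b / (n - 1)! * x ^ (n - 1)) dx → 0`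
  as `T → ∞`. -/
def IsRRCoeffs {k M : Type*} [Field k] [AddCommGroup M] [Module k M]
    (n : ℕ) (ℳ : ℝ → Submodule k M) (a b : ℝ) : Prop :=
  (∀ x : ℝ, FiniteDimensional k (⨆ (t : ℝ) (_ : t ≤ x), ℳ t : Submodule k M)) ∧
    ((fun x : ℝ => (dimLE ℳ x : ℝ) - a / (n ! : ℝ) * x ^ n) =O[atTop]
      fun x : ℝ => x ^ (n - 1)) ∧
    Tendsto
      (fun T : ℝ => 1 / T ^ n * ∫ x in (1 : ℝ)..T,
        ((dimLE ℳ x : ℝ) - a / (n ! : ℝ) * x ^ n - b / ((n - 1)! : ℝ) * x ^ (n - 1)))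
      atTop (𝓝 0)

/-- The coefficients `a_n(M)` and `a_{n-1}(M)` exist. -/
def HasRRCoeffs {k M : Type*} [Field k] [AddCommGroup M] [Module k M]
    (n : ℕ) (ℳ : ℝ → Submodule k M) : Prop :=
  ∃ a b : ℝ, IsRRCoeffs n ℳ a b

open Classical in
/-- The coefficient `a_{n-1}(M)` (and `0` if the coefficients do not exist). -/
def subCoeff {k M : Type*} [Field k] [AddCommGroup M] [Module k M]
    (n : ℕ) (ℳ : ℝ → Submodule k M) : ℝ :=
  if h : ∃ b a : ℝ, IsRRCoeffs n ℳ a b then h.choose else 0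

/-- The degree `deg M = a_{n-1}(M) - rank(M) * a_{n-1}(R)` of a graded module `M` with
components `ℳ` over a domain `R` of dimension `n` with components `𝒜`. -/
def gradedDegree {k R M : Type*} [Field k] [CommRing R] [Algebra k R]
    [AddCommGroup M] [Module k M] [Module R M]
    (n : ℕ) (𝒜 : ℝ → Submodule k R) (ℳ : ℝ → Submodule k M) : ℝ :=
  subCoeff n ℳ - (Module.finrank R M : ℝ) * subCoeff n 𝒜

/-- The grading of the dual module: the component of degree `l` consists of the `R`-linear maps
`M → R` that send `M_t` into `R_{l + t}` for every `t`, that is, of the degree-preserving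
`R`-linear maps `M(-l) → R`, where `M(-l)_t = M_{t - l}`. -/
def dualGrading {k R M : Type*} [Field k] [CommRing R] [Algebra k R]
    [AddCommGroup M] [Module k M] [Module R M]
    (𝒜 : ℝ → Submodule k R) (ℳ : ℝ → Submodule k M) (l : ℝ) :
    Submodule k (Module.Dual R M) where
  carrier := {f | ∀ t : ℝ, ∀ m ∈ ℳ t, f m ∈ 𝒜 (l + t)}
  add_mem' hf hg t m hm := by
    simpa using (𝒜 (l + t)).add_mem (hf t m hm) (hg t m hm)
  zero_mem' t m _ := by simp
  smul_mem' c f hf t m hm := by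
    simpa using (𝒜 (l + t)).smul_mem c (hf t m hm)

instance dualGrading_gradedSMul {k R M : Type*} [Field k] [CommRing R] [Algebra k R]
    [AddCommGroup M] [Module k M] [Module R M]
    (𝒜 : ℝ → Submodule k R) [GradedAlgebra 𝒜] (ℳ : ℝ → Submodule k M) :
    SetLike.GradedSMul 𝒜 (dualGrading 𝒜 ℳ) where
  smul_mem := by
    intro i j r f hr hf t m hm
    have h := SetLike.mul_mem_graded hr (hf t m hm)
    simpa [add_assoc, vadd_eq_add] using h

/-- The underlying `k`-linear map of the component of degree `l` of an `R`-linear map `f`. -/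
def dualComponentAux {k R M : Type*} [Field k] [CommRing R] [Algebra k R]
    [AddCommGroup M] [Module k M] [Module R M] [IsScalarTower k R M]
    (𝒜 : ℝ → Submodule k R) [GradedAlgebra 𝒜]
    (ℳ : ℝ → Submodule k M) [DirectSum.Decomposition ℳ]
    (l : ℝ) (f : Module.Dual R M) : M →ₗ[k] R :=
  (DirectSum.toModule k ℝ R fun t =>
      (GradedAlgebra.proj 𝒜 (l + t)) ∘ₗ (f.restrictScalars k) ∘ₗ (ℳ t).subtype) ∘ₗ
    (DirectSum.decomposeLinearEquiv ℳ).toLinearMap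

lemma dualComponentAux_of_mem {k R M : Type*} [Field k] [CommRing R] [Algebra k R]
    [AddCommGroup M] [Module k M] [Module R M] [IsScalarTower k R M]
    (𝒜 : ℝ → Submodule k R) [GradedAlgebra 𝒜]
    (ℳ : ℝ → Submodule k M) [DirectSum.Decomposition ℳ]
    (l : ℝ) (f : Module.Dual R M) {t : ℝ} {m : M} (hm : m ∈ ℳ t) :
    dualComponentAux 𝒜 ℳ l f m = (DirectSum.decompose 𝒜 (f m) (l + t) : R) := by
  simp only [dualComponentAux, LinearMap.comp_apply, LinearEquiv.coe_coe,
    DirectSum.decomposeLinearEquiv_apply, DirectSum.decompose_of_mem ℳ hm]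
  erw [DirectSum.toModule_lof]
  simp [GradedAlgebra.proj_apply]

/-- The component of degree `l` of an `R`-linear map `f : M → R`. -/
def dualComponent {k R M : Type*} [Field k] [CommRing R] [Algebra k R]
    [AddCommGroup M] [Module k M] [Module R M] [IsScalarTower k R M]
    (𝒜 : ℝ → Submodule k R) [GradedAlgebra 𝒜]
    (ℳ : ℝ → Submodule k M) [DirectSum.Decomposition ℳ] [SetLike.GradedSMul 𝒜 ℳ]
    (l : ℝ) (f : Module.Dual R M) : Module.Dual R M where
  toFun := dualComponentAux 𝒜 ℳ l f
  map_add' := map_add _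
  map_smul' r m := by
    induction r using DirectSum.Decomposition.inductionOn 𝒜 with
    | zero => simp
    | add r s hr hs => simp only [add_smul, map_add, hr, hs, RingHom.id_apply]
    | @homogeneous i r =>
      induction m using DirectSum.Decomposition.inductionOn ℳ with
      | zero => simp
      | add m m' h h' => simp only [smul_add, map_add, h, h']
      | @homogeneous t m =>
        have hm : (r : R) • (m : M) ∈ ℳ (i + t) := SetLike.GradedSMul.smul_mem r.2 m.2
        rw [dualComponentAux_of_mem 𝒜 ℳ l f hm, dualComponentAux_of_mem 𝒜 ℳ l f m.2,
          show l + (i + t) = i + (l + t) by ring, map_smul, smul_eq_mul,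
          DirectSum.coe_decompose_mul_add_of_left_mem 𝒜 r.2]
        rfl

lemma dualComponent_of_mem {k R M : Type*} [Field k] [CommRing R] [Algebra k R]
    [AddCommGroup M] [Module k M] [Module R M] [IsScalarTower k R M]
    (𝒜 : ℝ → Submodule k R) [GradedAlgebra 𝒜]
    (ℳ : ℝ → Submodule k M) [DirectSum.Decomposition ℳ] [SetLike.GradedSMul 𝒜 ℳ]
    (l : ℝ) (f : Module.Dual R M) {t : ℝ} {m : M} (hm : m ∈ ℳ t) :
    dualComponent 𝒜 ℳ l f m = (DirectSum.decompose 𝒜 (f m) (l + t) : R) :=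
  dualComponentAux_of_mem 𝒜 ℳ l f hm

/-- Over a graded ring, the dual of a finitely generated graded module is the internal direct
sum of the components `dualGrading`, so that `dualGrading` is a grading of `Module.Dual R M`. -/
theorem dualGrading_isInternal {k R M : Type*} [Field k] [CommRing R] [Algebra k R]
    [AddCommGroup M] [Module k M] [Module R M] [IsScalarTower k R M]
    (𝒜 : ℝ → Submodule k R) [GradedAlgebra 𝒜]
    (ℳ : ℝ → Submodule k M) [DirectSum.Decomposition ℳ] [SetLike.GradedSMul 𝒜 ℳ]
    [Module.Finite R M] : DirectSum.IsInternal (dualGrading 𝒜 ℳ) := by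
  classical
  have ext' : ∀ f g : Module.Dual R M, (∀ t, ∀ m ∈ ℳ t, f m = g m) → f = g := by
    intro f g h
    ext m
    induction m using DirectSum.Decomposition.inductionOn ℳ with
    | zero => simp
    | add m m' h h' => simp only [map_add, h, h']
    | homogeneous m => exact h _ _ m.2
  have hadd : ∀ l (f g : Module.Dual R M), dualComponent 𝒜 ℳ l (f + g) =
      dualComponent 𝒜 ℳ l f + dualComponent 𝒜 ℳ l g := by
    intro l f g
    refine ext' _ _ fun t m hm => ?_
    simp [dualComponent_of_mem 𝒜 ℳ l _ hm, DirectSum.decompose_add]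
  have hcoe : ∀ l (x : DirectSum ℝ fun i => dualGrading 𝒜 ℳ i),
      dualComponent 𝒜 ℳ l (DirectSum.coeAddMonoidHom (dualGrading 𝒜 ℳ) x) = x l := by
    intro l x
    induction x using DirectSum.induction_on with
    | zero =>
      refine ext' _ _ fun t m hm => ?_
      simp [dualComponent_of_mem 𝒜 ℳ l _ hm]
    | add x y hx hy => rw [map_add, hadd, hx, hy]; simp
    | of i f =>
      refine ext' _ _ fun t m hm => ?_
      rw [dualComponent_of_mem 𝒜 ℳ l _ hm, DirectSum.coeAddMonoidHom_of]
      have hf := f.2 t m hm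
      by_cases hil : i = l
      · subst hil
        rw [DirectSum.decompose_of_mem_same 𝒜 hf]
        simp
      · rw [DirectSum.decompose_of_mem_ne 𝒜 hf (by simpa using hil),
          DirectSum.of_eq_of_ne _ _ _ (Ne.symm hil)]
        simp
  refine ⟨fun x y hxy => ?_, fun f => ?_⟩
  · ext1 l
    exact Subtype.ext (by rw [← hcoe l x, ← hcoe l y, hxy])
  · have hmem : ∀ l, dualComponent 𝒜 ℳ l f ∈ dualGrading 𝒜 ℳ l := by
      intro l t m hm
      rw [dualComponent_of_mem 𝒜 ℳ l f hm]
      exact SetLike.coe_mem _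
    have hfin : ∀ m : M, ∃ S : Finset ℝ, ∀ S' : Finset ℝ, S ⊆ S' →
        ∑ l ∈ S', dualComponent 𝒜 ℳ l f m = f m := by
      intro m
      induction m using DirectSum.Decomposition.inductionOn ℳ with
      | zero => exact ⟨∅, by simp⟩
      | add m m' h h' =>
        obtain ⟨S, hS⟩ := h
        obtain ⟨T, hT⟩ := h'
        refine ⟨S ∪ T, fun S' hS' => ?_⟩
        simp only [map_add, Finset.sum_add_distrib]
        rw [hS S' (Finset.union_subset_left hS'), hT S' (Finset.union_subset_right hS')]
      | @homogeneous t m =>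
        refine ⟨(DirectSum.decompose 𝒜 (f m)).support.image (fun s => s - t),
          fun S' hS' => ?_⟩
        conv_rhs => rw [← DirectSum.sum_support_decompose 𝒜 (f (m : M))]
        rw [← Finset.sum_subset hS', Finset.sum_image (by intro a _ b _ h; simpa using h)]
        · refine Finset.sum_congr rfl fun s _ => ?_
          rw [dualComponent_of_mem 𝒜 ℳ _ f m.2, sub_add_cancel]
        · intro l _ hl
          rw [dualComponent_of_mem 𝒜 ℳ _ f m.2]
          by_contra hne
          refine hl (Finset.mem_image.2 ⟨l + t, ?_, by ring⟩)
          rw [DFinsupp.mem_support_iff]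
          exact fun h0 => hne (by rw [h0]; rfl)
    choose S hS using hfin
    obtain ⟨G, hG⟩ := (Module.finite_def.1 ‹Module.Finite R M› : (⊤ : Submodule R M).FG)
    refine ⟨∑ l ∈ G.biUnion S, DirectSum.of (fun i => dualGrading 𝒜 ℳ i) l ⟨_, hmem l⟩, ?_⟩
    rw [map_sum]
    simp only [DirectSum.coeAddMonoidHom_of]
    refine LinearMap.ext_on hG fun g hg => ?_
    rw [LinearMap.sum_apply]
    exact hS g _ (Finset.subset_biUnion_of_mem S hg)

/-- The coefficients `a_n(M)` and `a_{n-1}(M)` are unique. -/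
theorem IsRRCoeffs.unique {k M : Type*} [Field k] [AddCommGroup M] [Module k M]
    {n : ℕ} (hn : 1 ≤ n) {ℳ : ℝ → Submodule k M} {a b a' b' : ℝ}
    (h : IsRRCoeffs n ℳ a b) (h' : IsRRCoeffs n ℳ a' b') : a = a' ∧ b = b' := by
  obtain ⟨hfin, hO, hT⟩ := h
  obtain ⟨-, hO', hT'⟩ := h'
  have hn0 : (n ! : ℝ) ≠ 0 := by positivity
  have hm0 : ((n - 1)! : ℝ) ≠ 0 := by positivity
  have key : ∀ c : ℝ, ((fun x : ℝ => c * x ^ n) =O[atTop] fun x : ℝ => x ^ (n - 1)) →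
      c = 0 := by
    intro c hc
    by_contra hne
    have h1 : (fun x : ℝ => x ^ n) =O[atTop] fun x : ℝ => x ^ (n - 1) :=
      (isBigO_const_mul_left_iff hne).1 hc
    have h2 : (fun x : ℝ => x ^ (n - 1)) =o[atTop] fun x : ℝ => x ^ n :=
      isLittleO_pow_pow_atTop_of_lt (by omega)
    have h3 := (h1.trans_isLittleO h2)
    have h4 := isLittleO_irrefl (f'' := fun x : ℝ => x ^ n) (l := atTop)
      (Eventually.frequently ((eventually_gt_atTop 0).mono fun x hx => (pow_pos hx n).ne'))
    exact h4 h3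
  have ha : a = a' := by
    have := key (a' / (n ! : ℝ) - a / (n ! : ℝ)) ((hO.sub hO').congr_left fun x => by ring)
    field_simp at this
    linarith
  subst ha
  refine ⟨rfl, ?_⟩
  have hmono : Monotone fun x : ℝ => (dimLE ℳ x : ℝ) := by
    intro x y hxy
    have := hfin y
    have hle : (⨆ (t : ℝ) (_ : t ≤ x), ℳ t : Submodule k M) ≤
        (⨆ (t : ℝ) (_ : t ≤ y), ℳ t : Submodule k M) :=
      iSup_mono fun t => iSup_mono' fun h => ⟨h.trans hxy, le_rfl⟩
    exact Nat.cast_le.2 (Submodule.finrank_mono hle)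
  have hint : ∀ (c : ℝ) (T : ℝ), IntervalIntegrable (fun x : ℝ => (dimLE ℳ x : ℝ) -
      a / (n ! : ℝ) * x ^ n - c / ((n - 1)! : ℝ) * x ^ (n - 1)) MeasureTheory.volume 1 T := by
    intro c T
    exact (hmono.intervalIntegrable.sub (Continuous.intervalIntegrable (by fun_prop) _ _)).sub
      (Continuous.intervalIntegrable (by fun_prop) _ _)
  have hd := hT.sub hT'
  have heq : ∀ T : ℝ, 0 < T →
      1 / T ^ n * (∫ x in (1 : ℝ)..T, ((dimLE ℳ x : ℝ) - a / (n ! : ℝ) * x ^ n -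
          b / ((n - 1)! : ℝ) * x ^ (n - 1))) -
        1 / T ^ n * (∫ x in (1 : ℝ)..T, ((dimLE ℳ x : ℝ) - a / (n ! : ℝ) * x ^ n -
          b' / ((n - 1)! : ℝ) * x ^ (n - 1))) =
      (b' - b) / ((n - 1)! : ℝ) / n * (1 - (T ^ n)⁻¹) := by
    intro T hTpos
    rw [← mul_sub, ← intervalIntegral.integral_sub (hint b T) (hint b' T)]
    have : ∀ x : ℝ, ((dimLE ℳ x : ℝ) - a / (n ! : ℝ) * x ^ n -
          b / ((n - 1)! : ℝ) * x ^ (n - 1)) - ((dimLE ℳ x : ℝ) - a / (n ! : ℝ) * x ^ n -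
          b' / ((n - 1)! : ℝ) * x ^ (n - 1)) =
        (b' - b) / ((n - 1)! : ℝ) * x ^ (n - 1) := fun x => by ring
    simp only [this]
    rw [intervalIntegral.integral_const_mul, integral_pow, Nat.sub_add_cancel hn]
    have hnR : (n : ℝ) ≠ 0 := by exact_mod_cast (by omega : n ≠ 0)
    rw [Nat.cast_sub hn]
    simp only [one_pow, Nat.cast_one, sub_add_cancel]
    field_simp
  have hlim : Tendsto (fun T : ℝ => (b' - b) / ((n - 1)! : ℝ) / n * (1 - (T ^ n)⁻¹)) atTop
      (𝓝 ((b' - b) / ((n - 1)! : ℝ) / n * (1 - 0))) :=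
    ((tendsto_const_nhds.sub
      (tendsto_inv_atTop_zero.comp (tendsto_pow_atTop (by omega)))).const_mul _)
  have hd' := hd.congr' ((eventually_gt_atTop 0).mono heq)
  have := tendsto_nhds_unique hlim hd'
  have hnR : (n : ℝ) ≠ 0 := by exact_mod_cast (by omega : n ≠ 0)
  field_simp at this
  linarith

end

noncomputable section

open MeasureTheory Set

set_option linter.unusedSectionVars false

/-! ### Averaged asymptotic expansions -/

/-! With real degrees a Hilbert function may jump by amounts of order `x ^ (n - 1)`, so its second
coefficient exists only on average. It is therefore read off from the primitive: `HasExpansion s f α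
β` records the leading term of `f` and two terms of its integral. This notion is additive, behaves
well under shifts, and can be summed: an expansion of order `s` for `f x - f (x - d)` gives one of
order `s + 1` for `f` (`HasExpansion.of_sub_shift`). Prime filtrations and induction on coheight
then give expansions for all quotients `R / P` by homogeneous primes
(`hasExpansion_of_coheight_le`), hence for all quotients `N' / N` of homogeneous submodules killed
by a nonzero element.

For the duality, write `n = d + 1`. A torsion-free `M` contains a free `F` with homogeneous basis of
degrees `e i`, and a homogeneous `s ≠ 0` of degree `δ` satisfies `sF ⊆ sM ⊆ F`. Put `q = s²` and let
`N^♯` be the functionals on `M` sending `N` into `qR` (`dualInto`). Then `F^♯ ⊆ (sM)^♯ ⊆ (sF)^♯`,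
the outer modules are free with known degrees, and `(sM)^♯ = s M^∨`. The torsion quotient `sM / sF`
has growth of order `d`, so only its leading coefficient enters the second coefficient of `M`. It
enters with a plus sign for `M`, while that of `(sF)^♯ / (sM)^♯` enters with a minus sign for `M^∨`.
The theorem therefore amounts to the equality of these two leading coefficients.

Normality gives one inequality. For a nonzero homogeneous prime `P`, the leading coefficient of `(qR
: P) / qR`, which is `Ext¹(R / P, R)` up to shift if `q ∈ P`, is at most that of `R / P`
(`HasPrimeExpansions.leading_colonIdeal_le`). Filtering by primes, the leading coefficient of `N^♯ /
N'^♯` is at most that of `N' / N` (`HasPrimeExpansions.leading_dualInto_le`). Apply this to `sM /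
sF` and to `F / sM`. The totals agree, because `F / sF` and `(sF)^♯ / F^♯` are both sums of `rank M`
shifted copies of `R / sR`. So both inequalities are equalities, and no localization or Ext
computation is needed. -/

/-- Functions that vanish near `-∞`, are integrable on left half-lines and bounded on them. -/
structure IsTame (f : ℝ → ℝ) : Prop where
  vanish : ∃ L, ∀ x < L, f x = 0
  integrable : ∀ T, IntegrableOn f (Iic T)
  bounded : ∀ y, ∃ K, ∀ x ≤ y, |f x| ≤ K

/-- `f x = α x ^ s + O(s x ^ (s - 1))`, and the primitive of `f` vanishing near `-∞` is
`α / (s + 1) T ^ (s + 1) + β T ^ s + o(T ^ s)`. -/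
structure HasExpansion (s : ℕ) (f : ℝ → ℝ) (α β : ℝ) : Prop where
  tame : IsTame f
  approx : (fun x => f x - α * x ^ s) =O[atTop] fun x : ℝ => (s : ℝ) * x ^ (s - 1)
  average : (fun T => (∫ x in Iic T, f x) - (α / (s + 1) * T ^ (s + 1) + β * T ^ s)) =o[atTop]
    fun T : ℝ => T ^ s

/-- The factor `s` in the bound matters at `s = 0`: there the bound is identically zero, so the
hypothesis says that `g` vanishes eventually. This makes order `0` a valid start for inductions. -/
lemma isLittleO_of_isBigO_deriv {s : ℕ} {g : ℝ → ℝ}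
    (h : g =O[atTop] fun x : ℝ => (s : ℝ) * x ^ (s - 1)) : g =o[atTop] fun x : ℝ => x ^ s := by
  refine h.trans_isLittleO ?_
  cases s with
  | zero => simp
  | succ s =>
    exact IsLittleO.const_mul_left (isLittleO_pow_pow_atTop_of_lt (by omega)) _

/-! ### Powers and their backward differences -/

lemma sub_const_pow_isBigO (c : ℝ) (s : ℕ) :
    (fun x : ℝ => (x - c) ^ s) =O[atTop] fun x : ℝ => x ^ s := by
  refine IsBigO.pow ?_ s
  exact (isBigO_refl _ _).sub (isLittleO_const_id_atTop c).isBigO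

lemma pow_isBigO_deriv (s : ℕ) :
    (fun x : ℝ => x ^ s) =O[atTop] fun x : ℝ => ((s + 1 : ℕ) : ℝ) * x ^ (s + 1 - 1) := by
  have : ((s + 1 : ℕ) : ℝ) ≠ 0 := by positivity
  exact (isBigO_const_mul_self ((s + 1 : ℕ) : ℝ)⁻¹ _ _).congr_left
    (fun x => by simp only [Nat.add_sub_cancel]; field_simp)

lemma deriv_isBigO_pow (s : ℕ) :
    (fun x : ℝ => ((s + 1 : ℕ) : ℝ) * x ^ (s + 1 - 1)) =O[atTop] fun x : ℝ => x ^ s :=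
  isBigO_const_mul_self _ _ _

lemma mul_deriv_isBigO_deriv_succ (s : ℕ) :
    (fun x : ℝ => x * ((s : ℝ) * x ^ (s - 1))) =O[atTop]
      fun x : ℝ => ((s + 1 : ℕ) : ℝ) * x ^ (s + 1 - 1) := by
  refine IsBigO.trans ?_ (pow_isBigO_deriv s)
  refine (isBigO_const_mul_self (s : ℝ) (fun x : ℝ => x ^ s) _).congr_left fun x => ?_
  cases s with
  | zero => simp
  | succ s => simp only [Nat.add_sub_cancel]; ring

/-- First order expansion of a backward difference of powers. -/
lemma pow_sub_pow_shift_isBigO (c : ℝ) (s : ℕ) :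
    (fun x : ℝ => x ^ (s + 1) - (x - c) ^ (s + 1) - (s + 1) * c * x ^ s) =O[atTop]
      fun x : ℝ => (s : ℝ) * x ^ (s - 1) := by
  induction s with
  | zero =>
    simp only [zero_add, pow_one, pow_zero, CharP.cast_eq_zero]
    exact (isBigO_zero _ _).congr_left fun x => by ring
  | succ s ih =>
    have h1 := ((isBigO_refl (fun x : ℝ => x) atTop).mul ih).trans (mul_deriv_isBigO_deriv_succ s)
    have h2 : (fun x : ℝ => c * ((x - c) ^ (s + 1) - x ^ (s + 1))) =O[atTop]
        fun x : ℝ => ((s + 1 : ℕ) : ℝ) * x ^ (s + 1 - 1) := by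
      refine IsBigO.const_mul_left ?_ _
      have h3 := ih.trans ((isBigO_refl (fun x : ℝ => (s : ℝ) * x ^ (s - 1)) atTop).trans
        (isLittleO_of_isBigO_deriv (isBigO_refl _ _)).isBigO)
      have h4 : (fun x : ℝ => (s + 1) * c * x ^ s) =O[atTop] fun x : ℝ => x ^ s :=
        isBigO_const_mul_self _ _ _
      exact ((h3.add h4).neg_left.trans (pow_isBigO_deriv s)).congr_left fun x => by ring
    refine (h1.add h2).congr_left fun x => ?_
    push_cast
    ring

lemma pow_sub_pow_shift_isBigO' (c : ℝ) (s : ℕ) :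
    (fun x : ℝ => x ^ s - (x - c) ^ s) =O[atTop] fun x : ℝ => (s : ℝ) * x ^ (s - 1) := by
  cases s with
  | zero => exact (isBigO_zero _ _).congr_left fun x => by simp
  | succ s =>
    have h3 := (isLittleO_of_isBigO_deriv (pow_sub_pow_shift_isBigO c s)).isBigO
    have h4 : (fun x : ℝ => (s + 1) * c * x ^ s) =O[atTop] fun x : ℝ => x ^ s :=
        isBigO_const_mul_self _ _ _
    exact ((h3.add h4).trans (pow_isBigO_deriv s)).congr_left fun x => by ring

/-- Second order expansion of a backward difference of powers. -/
lemma pow_sub_pow_shift_isLittleO (c : ℝ) (s : ℕ) :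
    (fun x : ℝ => x ^ (s + 2) - (x - c) ^ (s + 2) - (s + 2) * c * x ^ (s + 1) +
      (s + 2) * (s + 1) / 2 * c ^ 2 * x ^ s) =o[atTop] fun x : ℝ => x ^ s := by
  induction s with
  | zero =>
    refine (isLittleO_zero _ _).congr_left fun x => ?_
    simp
    ring
  | succ s ih =>
    have h1 : (fun x : ℝ => x * (x ^ (s + 2) - (x - c) ^ (s + 2) - (s + 2) * c * x ^ (s + 1) +
        (s + 2) * (s + 1) / 2 * c ^ 2 * x ^ s)) =o[atTop] fun x : ℝ => x ^ (s + 1) :=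
      ((isBigO_refl (fun x : ℝ => x) atTop).mul_isLittleO ih).congr_right fun x => by ring
    have h2 := ((isLittleO_of_isBigO_deriv (pow_sub_pow_shift_isBigO c (s + 1))).const_mul_left c)
    refine (h1.sub h2).congr_left fun x => ?_
    push_cast
    ring

/-- Bernoulli's inequality in a form that telescopes: the increment of `x ^ s` over a step `d`
dominates `d` times the derivative at the left end. -/
lemma pow_add_mul_deriv_le {x d : ℝ} (hx : 0 ≤ x) (hd : 0 ≤ d) (s : ℕ) :
    x ^ s + d * ((s : ℝ) * x ^ (s - 1)) ≤ (x + d) ^ s := by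
  induction s with
  | zero => simp
  | succ s ih =>
    have h1 : (x ^ s + d * ((s : ℝ) * x ^ (s - 1))) * (x + d) ≤ (x + d) ^ (s + 1) := by
      rw [pow_succ]
      gcongr
    have h2 : (s : ℝ) * x ^ (s - 1) * x = s * x ^ s := by
      cases s with
      | zero => simp
      | succ s => simp only [Nat.add_sub_cancel]; ring
    have h3 : 0 ≤ d * ((s : ℝ) * x ^ (s - 1)) * d := by positivity
    have h4 : (x ^ s + d * ((s : ℝ) * x ^ (s - 1))) * (x + d) =
        x ^ (s + 1) + d * (((s : ℝ) + 1) * x ^ s) + d * ((s : ℝ) * x ^ (s - 1)) * d := by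
      have : d * ((s : ℝ) * x ^ (s - 1)) * x = d * (s * x ^ s) := by rw [mul_assoc, h2]
      linear_combination this
    push_cast
    linarith

/-! ### Summation: from bounds on backward differences to bounds on growth -/

/-- A bound on the backward differences of a function bounds the function. -/
lemma abs_le_of_abs_sub_shift_le {D : ℝ → ℝ} {d C x₀ K : ℝ} {s : ℕ} (hd : 0 < d) (hC : 0 ≤ C)
    (hx₀ : 0 ≤ x₀) (hdiff : ∀ x, x₀ ≤ x → |D x - D (x - d)| ≤ C * ((s : ℝ) * x ^ (s - 1)))
    (hK : ∀ x, x₀ - d ≤ x → x ≤ x₀ → |D x| ≤ K) {x : ℝ} (hx : x₀ ≤ x) :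
    |D x| ≤ C / d * (x + d) ^ s + K := by
  -- Induction on the number of steps of length `d` back to the initial window `[x₀ - d, x₀]`;
  -- evaluating the power at `x + d` absorbs each new increment.
  have key : ∀ j : ℕ, ∀ x, x₀ - d ≤ x → x ≤ x₀ + j * d → |D x| ≤ C / d * (x + d) ^ s + K := by
    intro j
    induction j with
    | zero =>
      intro x h1 h2
      have : 0 ≤ C / d * (x + d) ^ s := by
        have : 0 ≤ x + d := by linarith
        positivity
      linarith [hK x h1 (by simpa using h2)]
    | succ j ih =>
      intro x h1 h2
      by_cases hxx : x ≤ x₀ + j * d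
      · exact ih x h1 hxx
      have hj : 0 ≤ (j : ℝ) * d := by positivity
      have hx0 : x₀ ≤ x := by linarith
      have h3 := ih (x - d) (by linarith) (by push_cast at h2; linarith)
      rw [sub_add_cancel] at h3
      have h4 := hdiff x hx0
      have h5 := pow_add_mul_deriv_le (hx₀.trans hx0) hd.le s
      have h6 : C / d * (x ^ s + d * ((s : ℝ) * x ^ (s - 1))) ≤ C / d * (x + d) ^ s := by gcongr
      have h7 : C / d * (x ^ s + d * ((s : ℝ) * x ^ (s - 1))) =
          C / d * x ^ s + C * ((s : ℝ) * x ^ (s - 1)) := by field_simp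
      have h8 : |D x| ≤ |D x - D (x - d)| + |D (x - d)| := by
        simpa using abs_add_le (D x - D (x - d)) (D (x - d))
      linarith
  obtain ⟨j, hj⟩ := exists_nat_ge ((x - x₀) / d)
  refine key j x (by linarith) ?_
  rw [div_le_iff₀ hd] at hj
  linarith

lemma isBigO_pow_of_sub_shift {D : ℝ → ℝ} {d : ℝ} {s : ℕ} (hd : 0 < d)
    (hb : ∀ y, 0 ≤ y → ∃ K, ∀ x, y - d ≤ x → x ≤ y → |D x| ≤ K)
    (h : (fun x => D x - D (x - d)) =O[atTop] fun x : ℝ => (s : ℝ) * x ^ (s - 1)) :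
    D =O[atTop] fun x : ℝ => x ^ s := by
  obtain ⟨C, hC, h⟩ := h.exists_nonneg
  obtain ⟨x₀, hx₀⟩ := eventually_atTop.1 ((h.bound).and (eventually_ge_atTop 0))
  obtain ⟨K, hK⟩ := hb (max x₀ 0) (le_max_right _ _)
  have key : ∀ x, max x₀ 0 ≤ x → |D x| ≤ C / d * (x + d) ^ s + K := fun x hx =>
    abs_le_of_abs_sub_shift_le hd hC (le_max_right x₀ 0) (fun x hx => by
      have h1 := (hx₀ x ((le_max_left _ _).trans hx)).1
      have h2 : 0 ≤ (s : ℝ) * x ^ (s - 1) := by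
        have := (le_max_right x₀ 0).trans hx
        positivity
      rwa [Real.norm_eq_abs, Real.norm_eq_abs, abs_of_nonneg h2] at h1) hK hx
  have h1 : (fun x : ℝ => C / d * (x + d) ^ s + K) =O[atTop] fun x : ℝ => x ^ s := by
    refine IsBigO.add ?_ ?_
    · refine IsBigO.const_mul_left ?_ _
      simpa using sub_const_pow_isBigO (-d) s
    · cases s with
      | zero => exact (isBigO_const_const K (one_ne_zero (α := ℝ)) atTop).congr_right fun x => (pow_zero x).symm
      | succ s =>
        refine (isLittleO_const_left.2 (Or.inr ?_)).isBigO
        exact tendsto_norm_atTop_atTop.comp (tendsto_pow_atTop (by omega))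
  refine IsBigO.trans ?_ h1
  refine IsBigO.of_bound 1 ((eventually_ge_atTop (max x₀ 0)).mono fun x hx => ?_)
  rw [one_mul]
  exact (key x hx).trans (le_abs_self _)

lemma isLittleO_pow_of_sub_shift {D : ℝ → ℝ} {d : ℝ} {s : ℕ} (hd : 0 < d)
    (hb : ∀ y, 0 ≤ y → ∃ K, ∀ x, y - d ≤ x → x ≤ y → |D x| ≤ K)
    (h : (fun x => D x - D (x - d)) =o[atTop] fun x : ℝ => x ^ s) :
    D =o[atTop] fun x : ℝ => x ^ (s + 1) := by
  rw [isLittleO_iff]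
  intro ε hε
  have hs : (0 : ℝ) < s + 1 := by positivity
  -- Since `x + d ≤ 2 x` eventually, the summed bound costs a factor `2 ^ (s + 1)`; the remaining
  -- factor `2` leaves `ε / 2` for the constant `K`.
  set ε' : ℝ := ε * d / 2 ^ (s + 2) with hε'
  have hε'0 : 0 < ε' := by positivity
  obtain ⟨x₀, hx₀⟩ := eventually_atTop.1 (h.def hε'0)
  obtain ⟨K, hK⟩ := hb (max x₀ 0) (le_max_right _ _)
  have key : ∀ x, max x₀ 0 ≤ x → |D x| ≤ (ε' / (s + 1)) / d * (x + d) ^ (s + 1) + K := fun x hx =>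
    abs_le_of_abs_sub_shift_le hd (by positivity) (le_max_right x₀ 0) (fun x hx => by
      have h1 := hx₀ x ((le_max_left _ _).trans hx)
      have h2 : 0 ≤ x ^ s := pow_nonneg ((le_max_right x₀ 0).trans hx) s
      rw [Real.norm_eq_abs, Real.norm_eq_abs, abs_of_nonneg h2] at h1
      refine h1.trans (le_of_eq ?_)
      push_cast
      field_simp) hK hx
  have hbig : ∀ᶠ x : ℝ in atTop, 2 * K / ε ≤ x ^ (s + 1) :=
    (tendsto_pow_atTop (by omega)).eventually_ge_atTop _
  filter_upwards [hbig, eventually_ge_atTop (max x₀ 0), eventually_ge_atTop d] with x h1 h2 h3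
  have hx : 0 ≤ x := hd.le.trans h3
  rw [Real.norm_eq_abs, Real.norm_eq_abs, abs_of_nonneg (pow_nonneg hx _)]
  refine (key x h2).trans ?_
  have h4 : (x + d) ^ (s + 1) ≤ (2 * x) ^ (s + 1) := by
    gcongr
    linarith
  have h5 : ε' / (s + 1) ≤ ε' := div_le_self hε'0.le (by linarith [Nat.cast_nonneg (α := ℝ) s])
  have h6 : ε' / (s + 1) / d * (x + d) ^ (s + 1) ≤ ε' / d * (2 * x) ^ (s + 1) := by gcongr
  have h7 : ε' / d * (2 * x) ^ (s + 1) = ε / 2 * x ^ (s + 1) := by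
    rw [hε', mul_pow, pow_succ 2 (s + 1)]
    field_simp
  rw [div_le_iff₀ hε] at h1
  linarith

/-! ### Closure properties of tame functions -/

namespace IsTame

variable {f g : ℝ → ℝ}

lemma add (hf : IsTame f) (hg : IsTame g) : IsTame fun x => f x + g x where
  vanish := by
    obtain ⟨L, hL⟩ := hf.vanish
    obtain ⟨L', hL'⟩ := hg.vanish
    refine ⟨min L L', fun x hx => ?_⟩
    rw [hL x (hx.trans_le (min_le_left _ _)), hL' x (hx.trans_le (min_le_right _ _)), add_zero]
  integrable T := (hf.integrable T).add (hg.integrable T)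
  bounded y := by
    obtain ⟨K, hK⟩ := hf.bounded y
    obtain ⟨K', hK'⟩ := hg.bounded y
    exact ⟨K + K', fun x hx => (abs_add_le _ _).trans (add_le_add (hK x hx) (hK' x hx))⟩

lemma const_mul (c : ℝ) (hf : IsTame f) : IsTame fun x => c * f x where
  vanish := by
    obtain ⟨L, hL⟩ := hf.vanish
    exact ⟨L, fun x hx => by rw [hL x hx, mul_zero]⟩
  integrable T := (hf.integrable T).const_mul c
  bounded y := by
    obtain ⟨K, hK⟩ := hf.bounded y
    exact ⟨|c| * K, fun x hx => by rw [abs_mul]; gcongr; exact hK x hx⟩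

lemma sub (hf : IsTame f) (hg : IsTame g) : IsTame fun x => f x - g x := by
  have := hf.add (hg.const_mul (-1))
  simpa [sub_eq_add_neg] using this

lemma setIntegral_shift (f : ℝ → ℝ) (c T : ℝ) :
    ∫ x in Iic T, f (x - c) = ∫ x in Iic (T - c), f x := by
  have := (measurePreserving_sub_right volume c).setIntegral_preimage_emb
    (MeasurableEquiv.subRight c).measurableEmbedding f (Iic (T - c))
  rw [← this]
  congr 2
  ext x
  simp

lemma shift (c : ℝ) (hf : IsTame f) : IsTame fun x => f (x - c) where
  vanish := by
    obtain ⟨L, hL⟩ := hf.vanish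
    exact ⟨L + c, fun x hx => hL _ (by linarith)⟩
  integrable T := by
    have := ((measurePreserving_sub_right volume c).integrableOn_comp_preimage
      (MeasurableEquiv.subRight c).measurableEmbedding (s := Iic (T - c))).2 (hf.integrable (T - c))
    convert! this using 1
    ext x
    simp
  bounded y := by
    obtain ⟨K, hK⟩ := hf.bounded (y - c)
    exact ⟨K, fun x hx => hK _ (by linarith)⟩

lemma abs_setIntegral_le (hf : IsTame f) {T y : ℝ} (h : T ≤ y) :
    |∫ x in Iic T, f x| ≤ ∫ x in Iic y, |f x| := by
  refine (abs_integral_le_integral_abs).trans ?_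
  exact setIntegral_mono_set (hf.integrable y).abs (ae_of_all _ fun x => abs_nonneg _)
    (Iic_subset_Iic.2 h).eventuallyLE

/-- A monotone function that vanishes near `-∞` is tame. -/
lemma of_monotone (hf : Monotone f) (hL : ∃ L, ∀ x < L, f x = 0) : IsTame f where
  vanish := hL
  integrable T := by
    obtain ⟨L, hL⟩ := hL
    have h1 : IntegrableOn f (Icc (L - 1) T) := (hf.monotoneOn _).integrableOn_isCompact isCompact_Icc
    have h2 : IntegrableOn f (Iio L) :=
      (integrableOn_congr_fun (fun x hx => hL x hx) measurableSet_Iio).2 integrableOn_zero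
    refine (h2.union h1).mono_set fun x hx => ?_
    by_cases h : x < L
    · exact Or.inl h
    · exact Or.inr ⟨by linarith [not_lt.1 h], hx⟩
  bounded y := by
    obtain ⟨L, hL⟩ := hL
    refine ⟨f y, fun x hx => ?_⟩
    have h0 : 0 ≤ f x := by
      have h1 : f (min x (L - 1)) = 0 := hL _ (by linarith [min_le_right x (L - 1)])
      rw [← h1]
      exact hf (min_le_left _ _)
    rw [abs_of_nonneg h0]
    exact hf hx

end IsTame

/-! ### Calculus of averaged expansions -/

namespace HasExpansion

variable {f g : ℝ → ℝ} {s : ℕ} {α β α' β' : ℝ}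

lemma add (hf : HasExpansion s f α β) (hg : HasExpansion s g α' β') :
    HasExpansion s (fun x => f x + g x) (α + α') (β + β') where
  tame := hf.tame.add hg.tame
  approx := (hf.approx.add hg.approx).congr_left fun x => by ring
  average := by
    refine (hf.average.add hg.average).congr_left fun T => ?_
    rw [integral_add (hf.tame.integrable T) (hg.tame.integrable T)]
    ring

lemma const_mul (c : ℝ) (hf : HasExpansion s f α β) :
    HasExpansion s (fun x => c * f x) (c * α) (c * β) where
  tame := hf.tame.const_mul c
  approx := (hf.approx.const_mul_left c).congr_left fun x => by ring
  average := by
    refine (hf.average.const_mul_left c).congr_left fun T => ?_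
    rw [integral_const_mul]
    ring

lemma sub (hf : HasExpansion s f α β) (hg : HasExpansion s g α' β') :
    HasExpansion s (fun x => f x - g x) (α - α') (β - β') := by
  have := hf.add (hg.const_mul (-1))
  simpa [sub_eq_add_neg] using this

lemma zero (s : ℕ) : HasExpansion s (fun _ => 0) 0 0 where
  tame := ⟨⟨0, fun _ _ => rfl⟩, fun _ => integrableOn_zero, fun _ => ⟨0, fun _ _ => by simp⟩⟩
  approx := by simpa using isBigO_zero _ _
  average := by simp

lemma sum {ι : Type*} {t : Finset ι} {f : ι → ℝ → ℝ} {α β : ι → ℝ}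
    (h : ∀ i ∈ t, HasExpansion s (f i) (α i) (β i)) :
    HasExpansion s (fun x => ∑ i ∈ t, f i x) (∑ i ∈ t, α i) (∑ i ∈ t, β i) := by
  classical
  induction t using Finset.induction_on with
  | empty => simpa using zero s
  | insert i t hi ih =>
    simp only [Finset.sum_insert hi]
    exact (h i (by simp)).add (ih fun j hj => h j (by simp [hj]))

/-- Translating the argument of `α / (s + 1) * T ^ (s + 1)` by `c` changes it by `-c α T ^ s` to
first order; the leading coefficient does not see it. -/
lemma shift (c : ℝ) (hf : HasExpansion s f α β) :
    HasExpansion s (fun x => f (x - c)) α (β - c * α) where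
  tame := hf.tame.shift c
  approx := by
    have ht : Tendsto (fun x : ℝ => x - c) atTop atTop := tendsto_atTop_add_const_right _ _ tendsto_id
    have h1 := hf.approx.comp_tendsto ht
    have h2 : ((fun x : ℝ => (s : ℝ) * x ^ (s - 1)) ∘ fun x : ℝ => x - c) =O[atTop]
        fun x : ℝ => (s : ℝ) * x ^ (s - 1) :=
      (isBigO_refl _ _).mul (sub_const_pow_isBigO c (s - 1))
    refine ((h1.trans h2).sub ((pow_sub_pow_shift_isBigO' c s).const_mul_left α)).congr_left
      fun x => ?_
    simp only [Function.comp_apply]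
    ring
  average := by
    have ht : Tendsto (fun x : ℝ => x - c) atTop atTop := tendsto_atTop_add_const_right _ _ tendsto_id
    have h1 := (hf.average.comp_tendsto ht).trans_isBigO (sub_const_pow_isBigO c s)
    have h2 := (isLittleO_of_isBigO_deriv (pow_sub_pow_shift_isBigO c s)).const_mul_left
      (α / (s + 1))
    have h3 := (isLittleO_of_isBigO_deriv (pow_sub_pow_shift_isBigO' c s)).const_mul_left β
    refine ((h1.sub h2).sub h3).congr_left fun T => ?_
    have hs : (s : ℝ) + 1 ≠ 0 := by positivity
    simp only [Function.comp_apply]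
    rw [IsTame.setIntegral_shift]
    field_simp
    ring

/-- Seen one order higher, the leading term of the primitive of `f` becomes its second term. This is
how leading coefficients of torsion modules enter degrees. -/
lemma raise (hf : HasExpansion s f α β) : HasExpansion (s + 1) f 0 (α / (s + 1)) where
  tame := hf.tame
  approx := by
    have h1 := (isLittleO_of_isBigO_deriv hf.approx).isBigO
    have h2 : (fun x : ℝ => α * x ^ s) =O[atTop] fun x : ℝ => x ^ s := isBigO_const_mul_self _ _ _
    exact ((h1.add h2).trans (pow_isBigO_deriv s)).congr_left fun x => by ring
  average := by
    have h0 : (fun x : ℝ => x ^ s) =o[atTop] fun x : ℝ => x ^ (s + 1) :=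
      isLittleO_pow_pow_atTop_of_lt (by omega)
    refine ((hf.average.trans h0).add (h0.const_mul_left β)).congr_left fun T => ?_
    ring

lemma tendsto_div (hf : HasExpansion s f α β) :
    Tendsto (fun x => f x / x ^ s) atTop (𝓝 α) := by
  have h1 := (isLittleO_of_isBigO_deriv hf.approx).tendsto_div_nhds_zero
  have h2 := h1.add_const α
  rw [zero_add] at h2
  refine h2.congr' ((eventually_gt_atTop 0).mono fun x hx => ?_)
  have : x ^ s ≠ 0 := (pow_pos hx s).ne'
  field_simp
  ring

lemma leading_le (hf : HasExpansion s f α β) (hg : HasExpansion s g α' β')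
    (h : ∀ x, f x ≤ g x) : α ≤ α' := by
  refine le_of_tendsto_of_tendsto hf.tendsto_div hg.tendsto_div
    ((eventually_gt_atTop 0).mono fun x hx => ?_)
  have := pow_pos hx s
  change f x / x ^ s ≤ g x / x ^ s
  gcongr
  exact h x

lemma leading_unique (hf : HasExpansion s f α β) (hg : HasExpansion s f α' β') : α = α' :=
  (hf.leading_le hg fun _ => le_rfl).antisymm (hg.leading_le hf fun _ => le_rfl)

/-- Summation: if the backward difference of `f` has an expansion of order `s`, then `f` has an
expansion of order `s + 1`. -/
lemma of_sub_shift {d : ℝ} (hd : 0 < d) (hf : IsTame f)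
    (h : HasExpansion s (fun x => f x - f (x - d)) α β) :
    ∃ α' β', HasExpansion (s + 1) f α' β' := by
  have hs : (s : ℝ) + 1 ≠ 0 := by positivity
  have hs2 : (s : ℝ) + 2 ≠ 0 := by positivity
  have hbdd : ∀ p : ℝ → ℝ, Continuous p → ∀ F : ℝ → ℝ, (∀ y, ∃ K, ∀ x ≤ y, |F x| ≤ K) →
      ∀ y, 0 ≤ y → ∃ K, ∀ x, y - d ≤ x → x ≤ y → |F x - p x| ≤ K := by
    intro p hp F hF y _
    obtain ⟨K, hK⟩ := hF y
    obtain ⟨K', hK'⟩ := (isCompact_Icc (a := y - d) (b := y)).exists_bound_of_continuousOn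
      hp.continuousOn
    exact ⟨K + K', fun x h1 h2 => (abs_sub _ _).trans (add_le_add (hK x h2) (hK' x ⟨h1, h2⟩))⟩
  -- `A` and `B` solve the linear system that equates the backward difference of `A / (s + 2) * T ^
  -- (s + 2) + B * T ^ (s + 1)` with `α / (s + 1) * T ^ (s + 1) + β * T ^ s` up to `o(T ^ s)`. The
  -- `d ^ 2` in `B` corrects for the second-order term of the difference.
  set A : ℝ := α / (d * (s + 1)) with hA
  set B : ℝ := (β + A * (s + 1) / 2 * d ^ 2) / (d * (s + 1)) with hB
  refine ⟨A, B, hf, ?_, ?_⟩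
  · refine IsBigO.trans ?_ (pow_isBigO_deriv s)
    refine isBigO_pow_of_sub_shift hd (hbdd _ (by fun_prop) f hf.bounded) ?_
    refine (h.approx.sub ((pow_sub_pow_shift_isBigO d s).const_mul_left A)).congr_left fun x => ?_
    rw [hA]
    field_simp
    ring
  · refine isLittleO_pow_of_sub_shift hd (hbdd _ (by fun_prop) _ fun y =>
      ⟨_, fun x hx => hf.abs_setIntegral_le hx⟩) ?_
    have h1 := h.average
    have h2 := (pow_sub_pow_shift_isLittleO d s).const_mul_left (A / (s + 2))
    have h3 := (isLittleO_of_isBigO_deriv (pow_sub_pow_shift_isBigO d s)).const_mul_left B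
    refine ((h1.sub h2).sub h3).congr_left fun T => ?_
    rw [integral_sub (hf.integrable T) ((hf.shift d).integrable T), IsTame.setIntegral_shift]
    have e1 : B * ((s + 1) * d) = β + A * (s + 1) / 2 * d ^ 2 := by
      rw [hB]; field_simp
    have e2 : A * d = α / (s + 1) := by
      rw [hA]; field_simp
    have e3 : A / (s + 2) * ((s + 2) * d * T ^ (s + 1)) = α / (s + 1) * T ^ (s + 1) := by
      rw [← e2]; field_simp
    have e4 : A / (s + 2) * ((s + 2) * (s + 1) / 2 * d ^ 2 * T ^ s) =
        A * (s + 1) / 2 * d ^ 2 * T ^ s := by field_simp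
    have e5 : (((s + 1 : ℕ) : ℝ) + 1) = s + 2 := by push_cast; ring
    rw [e5]
    linear_combination e3 - e4 + T ^ s * e1

/-- The unit step function. -/
lemma step : HasExpansion 0 (fun x => if 0 ≤ x then 1 else 0) 1 0 := by
  have ht : IsTame (fun x : ℝ => if 0 ≤ x then (1 : ℝ) else 0) := by
    refine IsTame.of_monotone (fun x y hxy => ?_) ⟨0, fun x hx => if_neg hx.not_ge⟩
    split_ifs with h1 h2
    · exact le_rfl
    · exact absurd (h1.trans hxy) h2
    · exact zero_le_one
    · exact le_rfl
  refine ⟨ht, ?_, ?_⟩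
  · refine (EventuallyEq.isBigO ?_).trans (isBigO_zero _ _)
    filter_upwards [eventually_ge_atTop 0] with x hx
    simp [hx]
  · refine (EventuallyEq.isBigO ?_).trans_isLittleO (isLittleO_zero _ _)
    filter_upwards [eventually_ge_atTop 0] with T hT
    have h1 : (fun x : ℝ => if 0 ≤ x then (1 : ℝ) else 0) = (Ici 0).indicator fun _ => 1 := by
      ext x
      simp [indicator]
    rw [h1, setIntegral_indicator measurableSet_Ici]
    have h2 : Iic T ∩ Ici 0 = Icc 0 T := by rw [inter_comm, Ici_inter_Iic]
    rw [h2]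
    simp [hT]

end HasExpansion

/-! ### From expansions to the coefficients of the statement -/

/-- An expansion of order `n ≥ 1` of the Hilbert function gives the first two averaged
coefficients. -/
lemma IsRRCoeffs.of_hasExpansion {k M : Type*} [Field k] [AddCommGroup M] [Module k M]
    {n : ℕ} (hn : 1 ≤ n) {ℳ : ℝ → Submodule k M} {α β : ℝ}
    (hfin : ∀ x : ℝ, FiniteDimensional k (⨆ (t : ℝ) (_ : t ≤ x), ℳ t : Submodule k M))
    (h : HasExpansion n (fun x => (dimLE ℳ x : ℝ)) α β) :
    IsRRCoeffs n ℳ (n ! * α) (n ! * β) := by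
  obtain ⟨m, rfl⟩ : ∃ m, n = m + 1 := ⟨n - 1, by omega⟩
  have hn0 : ((m + 1) ! : ℝ) ≠ 0 := by positivity
  have hm0 : (m ! : ℝ) ≠ 0 := by positivity
  refine ⟨hfin, ?_, ?_⟩
  · refine (h.approx.trans (deriv_isBigO_pow m)).congr_left fun x => ?_
    field_simp
  · have hav := h.average.tendsto_div_nhds_zero
    have e1 : ((m + 1) ! : ℝ) * α / ((m + 1) ! : ℝ) = α := by field_simp
    have e2 : ((m + 1) ! : ℝ) * β / ((m + 1 - 1) ! : ℝ) = (m + 1) * β := by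
      rw [Nat.add_sub_cancel, Nat.factorial_succ]
      push_cast
      field_simp
    rw [e1, e2]
    set f : ℝ → ℝ := fun x => (dimLE ℳ x : ℝ)
    -- The constant lost by integrating from `1` instead of from `-∞`; it disappears after division
    -- by `T ^ n`.
    set c : ℝ := (∫ x in Iic 1, f x) - (α / (((m + 1 : ℕ) : ℝ) + 1) + β)
    have hc : Tendsto (fun T : ℝ => c / T ^ (m + 1)) atTop (𝓝 0) :=
      tendsto_const_nhds.div_atTop (tendsto_pow_atTop (by omega))
    have := hav.sub hc
    rw [sub_zero] at this
    refine this.congr fun T => ?_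
    have hfi : IntervalIntegrable f volume 1 T :=
      ⟨(h.tame.integrable T).mono_set Ioc_subset_Iic_self,
        (h.tame.integrable 1).mono_set Ioc_subset_Iic_self⟩
    rw [intervalIntegral.integral_sub (hfi.sub (Continuous.intervalIntegrable (by fun_prop) _ _))
      (Continuous.intervalIntegrable (by fun_prop) _ _),
      intervalIntegral.integral_sub hfi (Continuous.intervalIntegrable (by fun_prop) _ _),
      intervalIntegral.integral_const_mul, intervalIntegral.integral_const_mul, integral_pow,
      integral_pow, ← intervalIntegral.integral_Iic_sub_Iic (h.tame.integrable 1)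
        (h.tame.integrable T), ← sub_div, one_div, inv_mul_eq_div]
    congr 1
    have hm1 : (m : ℝ) + 1 ≠ 0 := by positivity
    have hm2 : (m : ℝ) + 1 + 1 ≠ 0 := by positivity
    simp only [Nat.add_sub_cancel, c]
    push_cast
    field_simp
    ring

/-! ### Hilbert functions of homogeneous submodules -/

/-- Rank-nullity for the map `B → W / A` induced by `T`, written without quotients. All comparisons
of Hilbert functions along a short exact sequence reduce to it. -/
lemma finrank_map_sup_add_finrank_inf_comap {k V W : Type*} [Field k] [AddCommGroup V] [Module k V]
    [AddCommGroup W] [Module k W] (T : V →ₗ[k] W) (B : Submodule k V) (A : Submodule k W)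
    [FiniteDimensional k B] [FiniteDimensional k A] :
    Module.finrank k (B.map T ⊔ A : Submodule k W) +
      Module.finrank k (B ⊓ A.comap T : Submodule k V) =
      Module.finrank k B + Module.finrank k A := by
  have h1 := Submodule.finrank_sup_add_finrank_inf_eq (B.map T) A
  have hfd : FiniteDimensional k (B ⊓ A.comap T : Submodule k V) :=
    Submodule.finiteDimensional_of_le inf_le_left
  have rn : ∀ C : Submodule k V, FiniteDimensional k C →
      Module.finrank k (C.map T) + Module.finrank k (C ⊓ LinearMap.ker T : Submodule k V) =
        Module.finrank k C := by
    intro C hC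
    have h := LinearMap.finrank_range_add_finrank_ker (T.domRestrict C)
    rw [LinearMap.range_domRestrict] at h
    rw [← h]
    congr 1
    rw [LinearMap.ker_domRestrict, (Submodule.equivSubtypeMap C _).finrank_eq,
      Submodule.map_comap_subtype]
  have h2 := rn B inferInstance
  have h3 := rn _ hfd
  have h4 : (B ⊓ A.comap T) ⊓ LinearMap.ker T = B ⊓ LinearMap.ker T := by
    rw [inf_assoc, inf_eq_right.2 (LinearMap.ker_le_comap T)]
  have h5 : (B ⊓ A.comap T).map T = B.map T ⊓ A := by
    ext y
    constructor
    · rintro ⟨x, ⟨hx, hx'⟩, rfl⟩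
      exact ⟨⟨x, hx, rfl⟩, hx'⟩
    · rintro ⟨⟨x, hx, rfl⟩, hx'⟩
      exact ⟨x, ⟨hx, hx'⟩, rfl⟩
  rw [h4, h5] at h3
  omega

section Graded

variable {k R M : Type*} [Field k] [CommRing R] [Algebra k R]
  [AddCommGroup M] [Module k M] [Module R M] [IsScalarTower k R M]

/-- The subspace of elements all of whose components have degree at most `x`. -/
abbrev gradedLE {k M : Type*} [Field k] [AddCommGroup M] [Module k M]
    (ℳ : ℝ → Submodule k M) (x : ℝ) : Submodule k M :=
  ⨆ (t : ℝ) (_ : t ≤ x), ℳ t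

lemma le_gradedLE (ℳ : ℝ → Submodule k M) {t x : ℝ} (h : t ≤ x) : ℳ t ≤ gradedLE ℳ x :=
  le_iSup₂_of_le t h le_rfl

lemma gradedLE_mono (ℳ : ℝ → Submodule k M) : Monotone (gradedLE ℳ) := fun _ _ hxy =>
  iSup₂_le fun _ ht => le_gradedLE ℳ (ht.trans hxy)

/-- The Hilbert function of a submodule. -/
def hilb (ℳ : ℝ → Submodule k M) (N : Submodule R M) (x : ℝ) : ℝ :=
  (Module.finrank k (N.restrictScalars k ⊓ gradedLE ℳ x : Submodule k M) : ℝ)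

lemma hilb_top (ℳ : ℝ → Submodule k M) :
    hilb ℳ (⊤ : Submodule R M) = fun x => (dimLE ℳ x : ℝ) := by
  ext x
  rw [hilb, Submodule.restrictScalars_top, top_inf_eq, dimLE]

/-- Truncation: the sum of the components of degree at most `x`. -/
def truncate (ℳ : ℝ → Submodule k M) [DirectSum.Decomposition ℳ] (x : ℝ) : M →ₗ[k] M :=
  (DirectSum.toModule k ℝ M fun t => if t ≤ x then (ℳ t).subtype else 0) ∘ₗ
    (DirectSum.decomposeLinearEquiv ℳ).toLinearMap

variable (𝒜 : ℝ → Submodule k R) (ℳ : ℝ → Submodule k M)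

section Decomposition

variable [DirectSum.Decomposition ℳ]

lemma truncate_of_mem (x : ℝ) {t : ℝ} {m : M} (hm : m ∈ ℳ t) :
    truncate ℳ x m = if t ≤ x then m else 0 := by
  simp only [truncate, LinearMap.comp_apply, LinearEquiv.coe_coe,
    DirectSum.decomposeLinearEquiv_apply, DirectSum.decompose_of_mem ℳ hm]
  erw [DirectSum.toModule_lof]
  split_ifs <;> simp

lemma truncate_eq_self {x : ℝ} {m : M} (hm : m ∈ gradedLE ℳ x) : truncate ℳ x m = m := by
  have : gradedLE ℳ x ≤ LinearMap.eqLocus (truncate ℳ x) LinearMap.id := by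
    refine iSup₂_le fun t ht m hm => ?_
    simp [LinearMap.mem_eqLocus, truncate_of_mem ℳ x hm, ht]
  exact this hm

lemma truncate_mem_of_components {S : Submodule k M} (x : ℝ) {m : M}
    (h : ∀ t ≤ x, (DirectSum.decompose ℳ m t : M) ∈ S) : truncate ℳ x m ∈ S := by
  classical
  rw [← DirectSum.sum_support_decompose ℳ m, map_sum]
  refine Submodule.sum_mem _ fun t _ => ?_
  rw [truncate_of_mem ℳ x (SetLike.coe_mem _)]
  split_ifs with ht
  · exact h t ht
  · exact zero_mem _

lemma truncate_mem_gradedLE (x : ℝ) (m : M) : truncate ℳ x m ∈ gradedLE ℳ x :=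
  truncate_mem_of_components ℳ x fun _ ht => le_gradedLE ℳ ht (SetLike.coe_mem _)

lemma truncate_mem {N : Submodule R M} (hN : N.IsHomogeneous ℳ) (x : ℝ) {m : M} (hm : m ∈ N) :
    truncate ℳ x m ∈ N :=
  truncate_mem_of_components (S := N.restrictScalars k) ℳ x fun t _ => hN t hm

lemma exists_component_ne_zero {m : M} (hm : m ≠ 0) : ∃ t, (DirectSum.decompose ℳ m t : M) ≠ 0 := by
  classical
  by_contra! h
  apply hm
  rw [← DirectSum.sum_support_decompose ℳ m]
  exact Finset.sum_eq_zero fun t _ => h t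

end Decomposition

section

variable [GradedAlgebra 𝒜] [DirectSum.Decomposition ℳ] [SetLike.GradedSMul 𝒜 ℳ]

lemma smul_mem_add {i t : ℝ} {r : R} {m : M} (hr : r ∈ 𝒜 i) (hm : m ∈ ℳ t) :
    r • m ∈ ℳ (i + t) :=
  SetLike.GradedSMul.smul_mem hr hm

lemma truncate_smul (x : ℝ) {e : ℝ} {m : M} (hm : m ∈ ℳ e) (r : R) :
    truncate ℳ x (r • m) = truncate 𝒜 (x - e) r • m := by
  induction r using DirectSum.Decomposition.inductionOn 𝒜 with
  | zero => simp
  | add r s hr hs => simp only [add_smul, map_add, hr, hs]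
  | @homogeneous i r =>
    rw [truncate_of_mem ℳ x (smul_mem_add 𝒜 ℳ r.2 hm), truncate_of_mem 𝒜 _ r.2]
    simp only [le_sub_iff_add_le]
    split_ifs <;> simp

lemma decompose_smul_of_mem (t : ℝ) {e : ℝ} {m : M} (hm : m ∈ ℳ e) (r : R) :
    (DirectSum.decompose ℳ (r • m) t : M) = (DirectSum.decompose 𝒜 r (t - e) : R) • m := by
  induction r using DirectSum.Decomposition.inductionOn 𝒜 with
  | zero => simp
  | add r s hr hs =>
    simp only [add_smul, DirectSum.decompose_add, DirectSum.add_apply, Submodule.coe_add, hr, hs]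
  | @homogeneous i r =>
    have h := smul_mem_add 𝒜 ℳ r.2 hm
    by_cases hit : i + e = t
    · subst hit
      rw [DirectSum.decompose_of_mem_same ℳ h, add_sub_cancel_right,
        DirectSum.decompose_of_mem_same 𝒜 r.2]
    · rw [DirectSum.decompose_of_mem_ne ℳ h hit,
        DirectSum.decompose_of_mem_ne 𝒜 r.2 (fun h => hit (by linarith)), zero_smul]

lemma smul_mem_gradedLE {x e : ℝ} {m : M} (hm : m ∈ ℳ e) {r : R} (hr : r ∈ gradedLE 𝒜 (x - e)) :
    r • m ∈ gradedLE ℳ x := by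
  rw [← truncate_eq_self 𝒜 hr, ← truncate_smul 𝒜 ℳ x hm]
  exact truncate_mem_gradedLE ℳ x _

lemma isHomogeneous_top : (⊤ : Submodule R M).IsHomogeneous ℳ := fun _ _ _ => trivial

lemma isHomogeneous_bot : (⊥ : Submodule R M).IsHomogeneous ℳ := by
  rintro t m (rfl : m = 0)
  simp

lemma isHomogeneous_sup_span (𝒜 : ℝ → Submodule k R) [GradedAlgebra 𝒜]
    [SetLike.GradedSMul 𝒜 ℳ] {N : Submodule R M} (hN : N.IsHomogeneous ℳ) {e : ℝ} {m : M}
    (hm : m ∈ ℳ e) : (N ⊔ Submodule.span R {m}).IsHomogeneous ℳ := by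
  intro t y hy
  obtain ⟨n, hn, z, hz, rfl⟩ := Submodule.mem_sup.1 hy
  obtain ⟨r, rfl⟩ := Submodule.mem_span_singleton.1 hz
  rw [DirectSum.decompose_add, DirectSum.add_apply, Submodule.coe_add,
    decompose_smul_of_mem 𝒜 ℳ t hm]
  exact Submodule.add_mem_sup (hN t hn) (Submodule.smul_mem _ _ (Submodule.mem_span_singleton_self m))

/-- The ideal `(N : m)`. -/
def colonElem (N : Submodule R M) (m : M) : Ideal R := N.comap (LinearMap.toSpanSingleton R M m)

@[simp] lemma mem_colonElem {N : Submodule R M} {m : M} {r : R} :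
    r ∈ colonElem N m ↔ r • m ∈ N := by
  simp [colonElem]

lemma isHomogeneous_colonElem {N : Submodule R M} (hN : N.IsHomogeneous ℳ) {e : ℝ} {m : M}
    (hm : m ∈ ℳ e) : (colonElem N m).IsHomogeneous 𝒜 := by
  intro t r hr
  rw [mem_colonElem] at hr ⊢
  have := hN (t + e) hr
  rwa [decompose_smul_of_mem 𝒜 ℳ _ hm, add_sub_cancel_right] at this

/-- Adding a homogeneous element of degree `e` to `N` adds the Hilbert function of `R / (N : m)`,
shifted by `e`, to the Hilbert function of `N`. -/
lemma hilb_sup_span {N : Submodule R M} (hN : N.IsHomogeneous ℳ) {e : ℝ} {m : M} (hm : m ∈ ℳ e)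
    (hA : ∀ x, FiniteDimensional k (gradedLE 𝒜 x)) (hM : ∀ x, FiniteDimensional k (gradedLE ℳ x))
    (x : ℝ) :
    hilb ℳ (N ⊔ Submodule.span R {m}) x - hilb ℳ N x =
      hilb 𝒜 (⊤ : Ideal R) (x - e) - hilb 𝒜 (colonElem N m) (x - e) := by
  have := hA (x - e)
  have := hM x
  let T : R →ₗ[k] M := (LinearMap.toSpanSingleton R M m).restrictScalars k
  have hT : ∀ r, T r = r • m := fun r => rfl
  have hfd : FiniteDimensional k (N.restrictScalars k ⊓ gradedLE ℳ x : Submodule k M) :=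
    Submodule.finiteDimensional_of_le inf_le_right
  have key := finrank_map_sup_add_finrank_inf_comap T (gradedLE 𝒜 (x - e))
    (N.restrictScalars k ⊓ gradedLE ℳ x)
  have h1 : (gradedLE 𝒜 (x - e)).map T ⊔ (N.restrictScalars k ⊓ gradedLE ℳ x) =
      (N ⊔ Submodule.span R {m}).restrictScalars k ⊓ gradedLE ℳ x := by
    apply le_antisymm
    · refine sup_le ?_ (inf_le_inf_right _ fun y hy => Submodule.mem_sup_left hy)
      rintro _ ⟨r, hr, rfl⟩
      refine ⟨Submodule.mem_sup_right (Submodule.mem_span_singleton.2 ⟨r, rfl⟩), ?_⟩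
      exact smul_mem_gradedLE 𝒜 ℳ hm hr
    · rintro y ⟨hy1, hy2⟩
      obtain ⟨n, hn, z, hz, rfl⟩ := Submodule.mem_sup.1 hy1
      obtain ⟨r, rfl⟩ := Submodule.mem_span_singleton.1 hz
      -- The summands `n` and `r • m` may have components of degree above `x` that cancel.
      -- Truncating the whole sum removes them and keeps `n` in the homogeneous submodule `N`.
      rw [← truncate_eq_self ℳ hy2, map_add, truncate_smul 𝒜 ℳ x hm, add_comm]
      exact Submodule.add_mem_sup ⟨_, truncate_mem_gradedLE 𝒜 _ r, rfl⟩
        ⟨truncate_mem ℳ hN x hn, truncate_mem_gradedLE ℳ x n⟩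
  have h2 : gradedLE 𝒜 (x - e) ⊓ (N.restrictScalars k ⊓ gradedLE ℳ x).comap T =
      (colonElem N m).restrictScalars k ⊓ gradedLE 𝒜 (x - e) := by
    ext r
    constructor
    · rintro ⟨h, h', -⟩
      exact ⟨mem_colonElem.2 h', h⟩
    · rintro ⟨h, h'⟩
      exact ⟨h', mem_colonElem.1 h, smul_mem_gradedLE 𝒜 ℳ hm h'⟩
  rw [h1, h2] at key
  have h3 : hilb 𝒜 (⊤ : Ideal R) (x - e) = (Module.finrank k (gradedLE 𝒜 (x - e)) : ℝ) := by
    rw [hilb_top]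
    rfl
  rw [h3]
  simp only [hilb]
  have key' : ((_ : ℕ) : ℝ) = _ := congrArg (Nat.cast : ℕ → ℝ) key
  push_cast at key'
  linarith

end

lemma hilb_mono_left {N N' : Submodule R M} (h : N ≤ N')
    (hM : ∀ x, FiniteDimensional k (gradedLE ℳ x)) (x : ℝ) : hilb ℳ N x ≤ hilb ℳ N' x := by
  have := hM x
  have : FiniteDimensional k (N'.restrictScalars k ⊓ gradedLE ℳ x : Submodule k M) :=
    Submodule.finiteDimensional_of_le inf_le_right
  exact Nat.cast_le.2 (Submodule.finrank_mono (inf_le_inf_right _ h))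

lemma isTame_hilb (N : Submodule R M) (hM : ∀ x, FiniteDimensional k (gradedLE ℳ x))
    (hL : ∃ L, ∀ t < L, ℳ t = ⊥) : IsTame (hilb ℳ N) := by
  refine IsTame.of_monotone (fun x y hxy => ?_) ?_
  · have := hM y
    have : FiniteDimensional k (N.restrictScalars k ⊓ gradedLE ℳ y : Submodule k M) :=
      Submodule.finiteDimensional_of_le inf_le_right
    exact Nat.cast_le.2 (Submodule.finrank_mono (inf_le_inf_left _ (gradedLE_mono ℳ hxy)))
  · obtain ⟨L, hL⟩ := hL
    refine ⟨L, fun x hx => ?_⟩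
    have h : gradedLE ℳ x = ⊥ := by
      rw [eq_bot_iff]
      exact iSup₂_le fun t ht => (hL t (ht.trans_lt hx)).le
    rw [hilb, h, inf_bot_eq]
    simp

/-! ### Homogeneous generators and finite-dimensionality -/

section Finite

variable [GradedAlgebra 𝒜] [DirectSum.Decomposition ℳ] [SetLike.GradedSMul 𝒜 ℳ]

/-- Arbitrary coefficients can be replaced by their components of the right degree, since the
component of degree `t` of the combination is `m` itself. -/
lemma exists_homogeneous_coeffs {S : Finset M} {d : M → ℝ} (hd : ∀ g ∈ S, g ∈ ℳ (d g))
    {t : ℝ} {m : M} (hm : m ∈ ℳ t) (hmS : m ∈ Submodule.span R (S : Set M)) :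
    ∃ c : M → R, (∀ g, c g ∈ 𝒜 (t - d g)) ∧ m = ∑ g ∈ S, c g • g := by
  obtain ⟨c, -, rfl⟩ := Submodule.mem_span_finset.1 hmS
  refine ⟨fun g => DirectSum.decompose 𝒜 (c g) (t - d g), fun g => SetLike.coe_mem _, ?_⟩
  conv_lhs => rw [← DirectSum.decompose_of_mem_same ℳ hm]
  rw [DirectSum.decompose_sum, DFinsupp.finsetSum_apply, AddSubmonoidClass.coe_finsetSum]
  exact Finset.sum_congr rfl fun g hg => decompose_smul_of_mem 𝒜 ℳ t (hd g hg) _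

lemma span_homogeneous_eq_top : Submodule.span R {m : M | ∃ t, m ∈ ℳ t} = ⊤ := by
  classical
  rw [eq_top_iff]
  intro m _
  rw [← DirectSum.sum_support_decompose ℳ m]
  exact Submodule.sum_mem _ fun t _ => Submodule.subset_span ⟨t, SetLike.coe_mem _⟩

lemma exists_homogeneous_generators [Module.Finite R M] :
    ∃ (S : Finset M) (d : M → ℝ), (∀ g ∈ S, g ∈ ℳ (d g)) ∧
      Submodule.span R (S : Set M) = ⊤ := by
  classical
  have hfg : (Submodule.span R {m : M | ∃ t, m ∈ ℳ t}).FG := by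
    rw [span_homogeneous_eq_top]
    exact Module.finite_def.1 inferInstance
  obtain ⟨S, hS, hS'⟩ := (Submodule.fg_span_iff_fg_span_finset_subset _).1 hfg
  rw [span_homogeneous_eq_top] at hS'
  have hdeg : ∀ g, ∃ t, g ∈ S → g ∈ ℳ t := fun g => by
    by_cases hg : g ∈ S
    · obtain ⟨t, ht⟩ := hS hg
      exact ⟨t, fun _ => ht⟩
    · exact ⟨0, fun h => absurd h hg⟩
  choose d hd using hdeg
  exact ⟨S, d, hd, hS'.symm⟩

/-- The graded pieces of a Noetherian nonnegatively graded algebra with `R_0 = k` are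
finite-dimensional. -/
lemma finiteDimensional_gradedLE_ring [IsNoetherianRing R] (hneg : ∀ t < 0, 𝒜 t = ⊥)
    (hzero : ∀ r ∈ 𝒜 0, ∃ c : k, algebraMap k R c = r) (x : ℝ) :
    FiniteDimensional k (gradedLE 𝒜 x) := by
  classical
  obtain ⟨S, hS, hS'⟩ := (Submodule.fg_span_iff_fg_span_finset_subset
    {r : R | ∃ t > 0, r ∈ 𝒜 t}).1 (IsNoetherian.noetherian (R := R) (M := R) _)
  have hdeg : ∀ g, ∃ t : ℝ, g ∈ S → 0 < t ∧ g ∈ 𝒜 t := fun g => by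
    by_cases hg : g ∈ S
    · obtain ⟨t, ht⟩ := hS hg
      exact ⟨t, fun _ => ht⟩
    · exact ⟨0, fun h => absurd h hg⟩
  choose d hd using hdeg
  obtain ⟨δ, hδ, hδS⟩ : ∃ δ > 0, ∀ g ∈ S, δ ≤ d g := by
    rcases S.eq_empty_or_nonempty with rfl | hne
    · exact ⟨1, one_pos, by simp⟩
    · obtain ⟨g, hg, hmin⟩ := S.exists_min_image d hne
      exact ⟨d g, (hd g hg).1, hmin⟩
  -- The ideal generated by the elements of positive degree has finitely many homogeneous
  -- generators, of degree at least `δ > 0`. So an element of positive degree is a combination of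
  -- them with coefficients of degree lower by at least `δ`, and induction runs in steps of `δ`.
  have key : ∀ j : ℕ, ∀ x < j * δ, FiniteDimensional k (gradedLE 𝒜 x) := by
    intro j
    induction j with
    | zero =>
      intro x hx
      have : gradedLE 𝒜 x = ⊥ := by
        rw [eq_bot_iff]
        exact iSup₂_le fun t ht => (hneg t (ht.trans_lt (by simpa using hx))).le
      rw [this]
      infer_instance
    | succ j ih =>
      intro x hx
      have := ih (x - δ) (by push_cast at hx; linarith)
      have hle : gradedLE 𝒜 x ≤ Submodule.span k {(1 : R)} ⊔
          S.sup fun g => (gradedLE 𝒜 (x - δ)).map (LinearMap.mulRight k g) := by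
        refine iSup₂_le fun t ht r hr => ?_
        rcases lt_trichotomy t 0 with h | rfl | h
        · rw [hneg t h] at hr
          rw [(Submodule.mem_bot k).1 hr]
          exact zero_mem _
        · obtain ⟨c, rfl⟩ := hzero r hr
          refine Submodule.mem_sup_left (Submodule.mem_span_singleton.2 ⟨c, ?_⟩)
          rw [Algebra.algebraMap_eq_smul_one]
        · refine Submodule.mem_sup_right ?_
          have hrS : r ∈ Submodule.span R (S : Set R) := by
            rw [← hS']
            exact Submodule.subset_span ⟨t, h, hr⟩
          obtain ⟨c, hc, rfl⟩ := exists_homogeneous_coeffs 𝒜 𝒜 (fun g hg => (hd g hg).2) hr hrS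
          refine Submodule.sum_mem _ fun g hg => ?_
          refine (Finset.le_sup (f := fun g => (gradedLE 𝒜 (x - δ)).map (LinearMap.mulRight k g))
            hg) ⟨c g, le_gradedLE 𝒜 ?_ (hc g), rfl⟩
          linarith [hδS g hg]
      exact Submodule.finiteDimensional_of_le hle
  obtain ⟨j, hj⟩ := exists_nat_gt (x / δ)
  exact key j x (by rwa [div_lt_iff₀ hδ] at hj)

lemma finiteDimensional_gradedLE [Module.Finite R M]
    (hA : ∀ x, FiniteDimensional k (gradedLE 𝒜 x)) (x : ℝ) :
    FiniteDimensional k (gradedLE ℳ x) := by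
  classical
  obtain ⟨S, d, hd, hS⟩ := exists_homogeneous_generators (R := R) ℳ
  have hle : gradedLE ℳ x ≤ S.sup fun g => (gradedLE 𝒜 (x - d g)).map
      ((LinearMap.toSpanSingleton R M g).restrictScalars k) := by
    refine iSup₂_le fun t ht m hm => ?_
    obtain ⟨c, hc, rfl⟩ := exists_homogeneous_coeffs 𝒜 ℳ hd hm (hS ▸ Submodule.mem_top)
    refine Submodule.sum_mem _ fun g hg => ?_
    refine (Finset.le_sup (f := fun g => (gradedLE 𝒜 (x - d g)).map
      ((LinearMap.toSpanSingleton R M g).restrictScalars k)) hg)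
      ⟨c g, le_gradedLE 𝒜 ?_ (hc g), rfl⟩
    linarith
  exact Submodule.finiteDimensional_of_le hle

end Finite

end Graded

/-! ### Filtrations with prime quotients -/

section Graded

variable {k R M : Type*} [Field k] [CommRing R] [Algebra k R]
  [AddCommGroup M] [Module k M] [Module R M] [IsScalarTower k R M]
  (𝒜 : ℝ → Submodule k R) [GradedAlgebra 𝒜]
  (ℳ : ℝ → Submodule k M) [DirectSum.Decomposition ℳ] [SetLike.GradedSMul 𝒜 ℳ]

/-- If `N < N'` are homogeneous, then some homogeneous `m ∈ N'` has a prime colon ideal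
`(N : m)`. -/
lemma exists_isPrime_colonElem (𝒜 : ℝ → Submodule k R) [GradedAlgebra 𝒜]
    [SetLike.GradedSMul 𝒜 ℳ] [IsNoetherianRing R] {N N' : Submodule R M}
    (hN : N.IsHomogeneous ℳ) (hN' : N'.IsHomogeneous ℳ) (h : ¬ N' ≤ N) :
    ∃ e, ∃ m ∈ ℳ e, m ∈ N' ∧ m ∉ N ∧ (colonElem N m).IsPrime := by
  classical
  let Q : Set (Ideal R) := {J | ∃ e, ∃ m ∈ ℳ e, m ∈ N' ∧ m ∉ N ∧ colonElem N m = J}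
  have hQ : Q.Nonempty := by
    obtain ⟨m, hm, hmN⟩ := SetLike.not_le_iff_exists.1 h
    obtain ⟨t, ht⟩ : ∃ t, (DirectSum.decompose ℳ m t : M) ∉ N := by
      by_contra! hcon
      exact hmN ((hN.mem_iff ℳ).2 hcon)
    exact ⟨_, t, _, SetLike.coe_mem _, hN' t hm, ht, rfl⟩
  -- The graded form of the existence of associated primes: a maximal element among the colon ideals
  -- of homogeneous elements is prime. Primality may be tested on homogeneous elements, which keeps
  -- `b • m` homogeneous.
  obtain ⟨J, ⟨e, m, hme, hmN', hmN, rfl⟩, hmax⟩ := set_has_maximal_iff_noetherian.2 ‹_› Q hQ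
  refine ⟨e, m, hme, hmN', hmN, ?_⟩
  refine (isHomogeneous_colonElem 𝒜 ℳ hN hme).isPrime_of_homogeneous_mem_or_mem ?_ ?_
  · rw [Ne, Ideal.eq_top_iff_one, mem_colonElem, one_smul]
    exact hmN
  · rintro a b - ⟨i, hb⟩ hab
    by_contra! hcon
    obtain ⟨ha, hb'⟩ := hcon
    rw [mem_colonElem] at hab ha hb'
    refine hmax (colonElem N (b • m)) ⟨_, b • m, smul_mem_add 𝒜 ℳ hb hme,
      N'.smul_mem _ hmN', hb', rfl⟩ (lt_of_le_of_ne (fun r hr => ?_) fun heq => ha ?_)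
    · rw [mem_colonElem] at hr ⊢
      rw [smul_comm]
      exact N.smul_mem _ hr
    · rw [← mem_colonElem, heq, mem_colonElem, ← mul_smul]
      exact hab

/-- Descending induction on homogeneous submodules of `N'` by steps with prime quotients. -/
lemma homogeneous_induction (𝒜 : ℝ → Submodule k R) [GradedAlgebra 𝒜]
    [SetLike.GradedSMul 𝒜 ℳ] [IsNoetherianRing R] [Module.Finite R M] {N' : Submodule R M}
    (hN' : N'.IsHomogeneous ℳ) {C : Submodule R M → Prop} (top : C N')
    (step : ∀ N ≤ N', N.IsHomogeneous ℳ → ∀ e, ∀ m ∈ ℳ e, m ∈ N' → (colonElem N m).IsPrime →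
      C (N ⊔ Submodule.span R {m}) → C N)
    (N : Submodule R M) (hle : N ≤ N') (hN : N.IsHomogeneous ℳ) : C N := by
  induction N using WellFoundedGT.induction with
  | ind N ih =>
    by_cases h : N' ≤ N
    · rwa [le_antisymm hle h]
    · obtain ⟨e, m, hme, hmN', hmN, hp⟩ := exists_isPrime_colonElem ℳ 𝒜 hN hN' h
      refine step N hle hN e m hme hmN' hp (ih _ ?_ ?_ ?_)
      · exact left_lt_sup.2 fun h => hmN (h (Submodule.mem_span_singleton_self m))
      · exact sup_le hle ((Submodule.span_singleton_le_iff_mem _ _).2 hmN')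
      · exact isHomogeneous_sup_span ℳ 𝒜 hN hme

/-- If the quotients of `R` by the homogeneous primes containing `I` have expansions of order `d`
with leading coefficients in `S`, then so has every quotient `N' / N` killed by `I`. -/
lemma hasExpansion_of_primes [IsNoetherianRing R] [Module.Finite R M]
    (hA : ∀ x, FiniteDimensional k (gradedLE 𝒜 x)) (hM : ∀ x, FiniteDimensional k (gradedLE ℳ x))
    {d : ℕ} (S : AddSubmonoid ℝ) (I : Ideal R)
    (hP : ∀ P : Ideal R, P.IsPrime → P.IsHomogeneous 𝒜 → I ≤ P → ∃ α ∈ S, ∃ β,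
      HasExpansion d (fun x => hilb 𝒜 (⊤ : Ideal R) x - hilb 𝒜 P x) α β)
    {N N' : Submodule R M} (hN : N.IsHomogeneous ℳ) (hN' : N'.IsHomogeneous ℳ) (hle : N ≤ N')
    (hI : ∀ r ∈ I, ∀ m ∈ N', r • m ∈ N) :
    ∃ α ∈ S, ∃ β, HasExpansion d (fun x => hilb ℳ N' x - hilb ℳ N x) α β := by
  revert hI
  refine homogeneous_induction ℳ 𝒜 hN' (C := fun N => (∀ r ∈ I, ∀ m ∈ N', r • m ∈ N) →
    ∃ α ∈ S, ∃ β, HasExpansion d (fun x => hilb ℳ N' x - hilb ℳ N x) α β) ?_ ?_ N hle hN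
  · intro _
    exact ⟨0, S.zero_mem, 0, by simpa using HasExpansion.zero d⟩
  -- Adjoining `m` contributes `R / (N : m)` shifted by `e`. The prime `(N : m)` contains `I`,
  -- because `I` carries `N'` into `N`.
  · intro N hle hN e m hme hmN' hp ih hI
    obtain ⟨α, hα, β, h⟩ := ih fun r hr m hm => Submodule.mem_sup_left (hI r hr m hm)
    obtain ⟨α', hα', β', h'⟩ := hP _ hp (isHomogeneous_colonElem 𝒜 ℳ hN hme)
      fun r hr => mem_colonElem.2 (hI r hr m hmN')
    refine ⟨α + α', S.add_mem hα hα', β + (β' - e * α'), ?_⟩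
    convert! h.add (h'.shift e) using 2 with x
    rw [← hilb_sup_span 𝒜 ℳ hN hme hA hM]
    ring

lemma HasExpansion.exists_of_le {s d : ℕ} (hsd : s ≤ d) {f : ℝ → ℝ}
    (h : ∃ α β, HasExpansion s f α β) : ∃ α β, HasExpansion d f α β := by
  induction d, hsd using Nat.le_induction with
  | base => exact h
  | succ d _ ih =>
    obtain ⟨α, β, h⟩ := ih
    exact ⟨_, _, h.raise⟩

/-- If a homogeneous prime contains all elements of positive degree, the Hilbert function of the
quotient is the unit step. -/
lemma hilb_quotient_eq_step (hneg : ∀ t < 0, 𝒜 t = ⊥)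
    (hzero : ∀ r ∈ 𝒜 0, ∃ c : k, algebraMap k R c = r)
    (hA : ∀ x, FiniteDimensional k (gradedLE 𝒜 x)) {P : Ideal R} (hP1 : P ≠ ⊤)
    (hpos : ∀ t > 0, ∀ r ∈ 𝒜 t, r ∈ P) (x : ℝ) :
    hilb 𝒜 (⊤ : Ideal R) x - hilb 𝒜 P x = if 0 ≤ x then 1 else 0 := by
  split_ifs with hx
  · have := hA x
    have hfd : FiniteDimensional k (P.restrictScalars k ⊓ gradedLE 𝒜 x : Submodule k R) :=
      Submodule.finiteDimensional_of_le inf_le_right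
    have key := finrank_map_sup_add_finrank_inf_comap (Algebra.linearMap k R) ⊤
      (P.restrictScalars k ⊓ gradedLE 𝒜 x)
    have h1 : (⊤ : Submodule k k).map (Algebra.linearMap k R) ⊔
        (P.restrictScalars k ⊓ gradedLE 𝒜 x) = gradedLE 𝒜 x := by
      apply le_antisymm
      · refine sup_le ?_ inf_le_right
        rintro _ ⟨c, -, rfl⟩
        refine le_gradedLE 𝒜 hx ?_
        rw [Algebra.linearMap_apply, Algebra.algebraMap_eq_smul_one]
        exact (𝒜 0).smul_mem c (SetLike.GradedOne.one_mem)
      · refine iSup₂_le fun t ht r hr => ?_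
        rcases lt_trichotomy t 0 with h | rfl | h
        · rw [hneg t h, Submodule.mem_bot] at hr
          rw [hr]
          exact zero_mem _
        · obtain ⟨c, rfl⟩ := hzero r hr
          exact Submodule.mem_sup_left ⟨c, trivial, rfl⟩
        · exact Submodule.mem_sup_right ⟨hpos t h r hr, le_gradedLE 𝒜 ht hr⟩
    have h2 : (⊤ : Submodule k k) ⊓
        (P.restrictScalars k ⊓ gradedLE 𝒜 x).comap (Algebra.linearMap k R) = ⊥ := by
      rw [eq_bot_iff]
      rintro c ⟨-, hc, -⟩
      by_contra hne
      refine hP1 (Ideal.eq_top_of_isUnit_mem P hc ?_)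
      exact (IsUnit.mk0 c hne).map (algebraMap k R)
    rw [h1, h2, finrank_bot, finrank_top, Module.finrank_self] at key
    have h3 : hilb 𝒜 (⊤ : Ideal R) x = (Module.finrank k (gradedLE 𝒜 x) : ℝ) := by
      rw [hilb_top]
      rfl
    rw [h3, ← add_zero (Module.finrank k (gradedLE 𝒜 x)), key, hilb]
    push_cast
    ring
  · have h : gradedLE 𝒜 x = ⊥ := by
      rw [eq_bot_iff]
      exact iSup₂_le fun t ht => (hneg t (ht.trans_lt (not_le.1 hx))).le
    rw [hilb, hilb, h, inf_bot_eq, inf_bot_eq, sub_self]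

/-- The quotient of `R` by a homogeneous prime of coheight at most `d` has an expansion of
order `d`. -/
lemma hasExpansion_of_coheight_le [IsNoetherianRing R] (hneg : ∀ t < 0, 𝒜 t = ⊥)
    (hzero : ∀ r ∈ 𝒜 0, ∃ c : k, algebraMap k R c = r)
    (hA : ∀ x, FiniteDimensional k (gradedLE 𝒜 x)) (d : ℕ) (P : Ideal R) (hP : P.IsPrime)
    (hPh : P.IsHomogeneous 𝒜) (h : Order.coheight (⟨P, hP⟩ : PrimeSpectrum R) ≤ d) :
    ∃ α β, HasExpansion d (fun x => hilb 𝒜 (⊤ : Ideal R) x - hilb 𝒜 P x) α β := by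
  induction d generalizing P with
  | zero =>
    -- A maximal homogeneous `P` contains every `c` of degree `t > 0`. Otherwise `1 = p + r c`; the
    -- degree `0` part of `r c` involves `r` in degree `-t` and vanishes, so `1` is the degree `0`
    -- part of `p` and lies in `P`.
    have hstep := hilb_quotient_eq_step 𝒜 hneg hzero hA hP.ne_top fun t ht c hc => by
      by_contra hcP
      have hmax : IsMax (⟨P, hP⟩ : PrimeSpectrum R) := by simpa using h
      have htop : P ⊔ Ideal.span {c} = ⊤ := by
        by_contra hne
        obtain ⟨Q, hQ, hle⟩ := Ideal.exists_le_maximal _ hne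
        have h1 : (⟨P, hP⟩ : PrimeSpectrum R) ≤ ⟨Q, hQ.isPrime⟩ := le_sup_left.trans hle
        exact hcP (hmax h1 ((le_sup_right.trans hle) (Ideal.mem_span_singleton_self c)))
      have h1 : (1 : R) ∈ P ⊔ Ideal.span {c} := htop ▸ Submodule.mem_top
      obtain ⟨p, hp, y, hy, hpy⟩ := Submodule.mem_sup.1 h1
      obtain ⟨r, rfl⟩ := Ideal.mem_span_singleton'.1 hy
      have h2 : (DirectSum.decompose 𝒜 (p + r * c) 0 : R) = 1 := by
        rw [hpy]
        exact DirectSum.decompose_of_mem_same 𝒜 SetLike.GradedOne.one_mem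
      rw [DirectSum.decompose_add, DirectSum.add_apply, Submodule.coe_add, ← smul_eq_mul,
        decompose_smul_of_mem 𝒜 𝒜 0 hc] at h2
      have h3 : (DirectSum.decompose 𝒜 r (0 - t) : R) = 0 := by
        exact (Submodule.mem_bot k).1 (hneg (0 - t) (by linarith) ▸
          (SetLike.coe_mem (DirectSum.decompose 𝒜 r (0 - t)) :))
      rw [h3, zero_smul, add_zero] at h2
      exact hP.ne_top ((Ideal.eq_top_iff_one P).2 (h2 ▸ hPh 0 hp))
    simp only [hstep]
    exact ⟨_, _, HasExpansion.step⟩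
  | succ d ih =>
    by_cases hpos : ∀ t > 0, ∀ r ∈ 𝒜 t, r ∈ P
    · simp only [hilb_quotient_eq_step 𝒜 hneg hzero hA hP.ne_top hpos]
      exact HasExpansion.exists_of_le (Nat.zero_le _) ⟨_, _, HasExpansion.step⟩
    · push Not at hpos
      obtain ⟨γ, hγ, c, hc, hcP⟩ := hpos
      -- As `c` is a nonzerodivisor on `R / P`, the Hilbert function of `R / (P + cR)` is a backward
      -- difference of that of `R / P`. Primes containing `P + cR` lie strictly above `P`, so the
      -- induction hypothesis covers them. The submonoid `⊤` puts no condition on leading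
      -- coefficients.
      obtain ⟨α, -, β, hexp⟩ := hasExpansion_of_primes 𝒜 𝒜 hA hA (d := d) ⊤ (P ⊔ Ideal.span {c})
        (fun Q hQ hQh hle => by
          have hlt : (⟨P, hP⟩ : PrimeSpectrum R) < ⟨Q, hQ⟩ := by
            refine lt_of_le_of_ne (le_sup_left.trans hle : P ≤ Q) fun heq => hcP ?_
            have : P = Q := congrArg PrimeSpectrum.asIdeal heq
            rw [this]
            exact (le_sup_right.trans hle) (Ideal.mem_span_singleton_self c)
          have h1 := (Order.coheight_add_one_le hlt).trans h
          push_cast at h1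
          obtain ⟨α, β, h2⟩ := ih Q hQ hQh (by
            exact (ENat.add_le_add_iff_right ENat.one_ne_top).1 h1)
          exact ⟨α, trivial, β, h2⟩)
        (N := P ⊔ Ideal.span {c}) (N' := ⊤) (isHomogeneous_sup_span 𝒜 𝒜 hPh hc)
        (isHomogeneous_top 𝒜) le_top (fun r hr m _ => Ideal.mul_mem_right m _ hr)
      have hcolon : colonElem P c = P := by
        ext r
        rw [mem_colonElem, smul_eq_mul]
        exact ⟨fun h => (hP.mem_or_mem h).resolve_right hcP, fun h => P.mul_mem_right _ h⟩
      have hsup := hilb_sup_span 𝒜 𝒜 hPh hc hA hA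
      rw [hcolon] at hsup
      have hL : ∃ L, ∀ t < L, 𝒜 t = ⊥ := ⟨0, hneg⟩
      refine HasExpansion.of_sub_shift (d := γ) hγ
        ((isTame_hilb 𝒜 _ hA hL).sub (isTame_hilb 𝒜 _ hA hL)) (α := α) (β := β) ?_
      convert! hexp using 2 with x
      have := hsup x
      rw [Ideal.span]
      linarith

end Graded

/-! ### Leading coefficients of duals of torsion modules -/

section Graded

variable {k R M : Type*} [Field k] [CommRing R] [Algebra k R]
  [AddCommGroup M] [Module k M] [Module R M] [IsScalarTower k R M]
  (𝒜 : ℝ → Submodule k R) [GradedAlgebra 𝒜]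
  (ℳ : ℝ → Submodule k M) [DirectSum.Decomposition ℳ] [SetLike.GradedSMul 𝒜 ℳ]

/-- The quotients of `R` by nonzero homogeneous primes have expansions of order `d`, and those by
primes that are not minimal among these have leading coefficient `0`. -/
structure HasPrimeExpansions (d : ℕ) : Prop where
  finite : ∀ x, FiniteDimensional k (gradedLE 𝒜 x)
  ne_bot : ∀ P : Ideal R, P.IsPrime → P.IsHomogeneous 𝒜 → P ≠ ⊥ →
    ∃ α β, HasExpansion d (fun x => hilb 𝒜 (⊤ : Ideal R) x - hilb 𝒜 P x) α β
  not_minimal : ∀ P Q : Ideal R, P.IsPrime → Q.IsPrime → Q.IsHomogeneous 𝒜 → P ≠ ⊥ → P < Q →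
    ∃ β, HasExpansion d (fun x => hilb 𝒜 (⊤ : Ideal R) x - hilb 𝒜 Q x) 0 β

/-- In a domain of dimension `d + 1` a nonzero prime has coheight at most `d`. A prime strictly
above it has coheight at most `d - 1`, so its quotient has an expansion of order `d - 1`, which
`raise` turns into one with leading coefficient `0`. -/
lemma hasPrimeExpansions [IsDomain R] [IsNoetherianRing R] (hneg : ∀ t < 0, 𝒜 t = ⊥)
    (hzero : ∀ r ∈ 𝒜 0, ∃ c : k, algebraMap k R c = r) {d : ℕ}
    (hdim : ringKrullDim R = (d + 1 : ℕ)) : HasPrimeExpansions 𝒜 d := by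
  have hA := finiteDimensional_gradedLE_ring 𝒜 hneg hzero
  have hP : ∀ (P : Ideal R) (hP : P.IsPrime), P ≠ ⊥ →
      Order.coheight (⟨P, hP⟩ : PrimeSpectrum R) ≤ d := by
    intro P hP hne
    have hlt : (⟨⊥, Ideal.isPrime_bot⟩ : PrimeSpectrum R) < ⟨P, hP⟩ :=
      (bot_lt_iff_ne_bot.2 hne : (⊥ : Ideal R) < P)
    have h1 : ((Order.coheight (⟨P, hP⟩ : PrimeSpectrum R) + 1 : ℕ∞) : WithBot ℕ∞) ≤
        ((d + 1 : ℕ) : WithBot ℕ∞) := by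
      rw [← hdim]
      exact (WithBot.coe_le_coe.2 (Order.coheight_add_one_le hlt)).trans
        (Order.coheight_le_krullDim _)
    have h2 : Order.coheight (⟨P, hP⟩ : PrimeSpectrum R) + 1 ≤ ((d + 1 : ℕ) : ℕ∞) :=
      WithBot.coe_le_coe.1 h1
    push_cast at h2
    exact (ENat.add_le_add_iff_right ENat.one_ne_top).1 h2
  refine ⟨hA, fun P hPp hPh hne => hasExpansion_of_coheight_le 𝒜 hneg hzero hA d P hPp hPh
    (hP P hPp hne), fun P Q hPp hQ hQh hne hPQ => ?_⟩
  have hlt : (⟨P, hPp⟩ : PrimeSpectrum R) < ⟨Q, hQ⟩ := hPQ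
  have h1 := (Order.coheight_add_one_le hlt).trans (hP P hPp hne)
  cases d with
  | zero => simp at h1
  | succ d =>
    push_cast at h1
    obtain ⟨α, β, h2⟩ := hasExpansion_of_coheight_le 𝒜 hneg hzero hA d Q hQ hQh
      ((ENat.add_le_add_iff_right ENat.one_ne_top).1 h1)
    exact ⟨_, h2.raise⟩

variable {𝒜} in
/-- A quotient killed by a nonzero element has an expansion. -/
lemma HasPrimeExpansions.of_smul_mem [IsNoetherianRing R] [Module.Finite R M] {d : ℕ}
    (h : HasPrimeExpansions 𝒜 d) {s : R} (hs : s ≠ 0) {N N' : Submodule R M}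
    (hN : N.IsHomogeneous ℳ) (hN' : N'.IsHomogeneous ℳ) (hle : N ≤ N')
    (hsN : ∀ m ∈ N', s • m ∈ N) :
    ∃ α β, HasExpansion d (fun x => hilb ℳ N' x - hilb ℳ N x) α β := by
  obtain ⟨α, -, β, hexp⟩ := hasExpansion_of_primes 𝒜 ℳ h.finite
    (finiteDimensional_gradedLE 𝒜 ℳ h.finite) (d := d) ⊤ (Ideal.span {s})
    (fun P hP hPh hsP => by
      obtain ⟨α, β, h1⟩ := h.ne_bot P hP hPh fun h0 => hs (by
        simpa [h0] using hsP (Ideal.mem_span_singleton_self s))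
      exact ⟨α, trivial, β, h1⟩) hN hN' hle (fun r hr m hm => by
        obtain ⟨c, rfl⟩ := Ideal.mem_span_singleton'.1 hr
        rw [mul_smul]
        exact N.smul_mem c (hsN m hm))
  exact ⟨α, β, hexp⟩

lemma isHomogeneous_span_singleton {q : R} {e : ℝ} (hq : q ∈ 𝒜 e) :
    (Ideal.span {q}).IsHomogeneous 𝒜 := by
  have := isHomogeneous_sup_span 𝒜 𝒜 (isHomogeneous_bot (R := R) 𝒜) hq
  rwa [bot_sup_eq] at this

/-- The ideal `(J : P)`. -/
def colonIdeal (J P : Ideal R) : Ideal R where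
  carrier := {a | ∀ p ∈ P, a * p ∈ J}
  add_mem' ha hb p hp := by simpa [add_mul] using J.add_mem (ha p hp) (hb p hp)
  zero_mem' p _ := by simp
  smul_mem' c a ha p hp := by simpa [mul_assoc] using J.mul_mem_left c (ha p hp)

lemma le_colonIdeal (J P : Ideal R) : J ≤ colonIdeal J P := fun _ ha p _ => J.mul_mem_right p ha

lemma isHomogeneous_colonIdeal {J P : Ideal R} (hJ : J.IsHomogeneous 𝒜)
    (hP : P.IsHomogeneous 𝒜) : (colonIdeal J P).IsHomogeneous 𝒜 := by
  classical
  intro t a ha p hp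
  rw [← DirectSum.sum_support_decompose 𝒜 p, Finset.mul_sum]
  refine J.sum_mem fun i _ => ?_
  have h1 := hJ (t + i) (ha _ (hP i hp))
  rwa [← smul_eq_mul, decompose_smul_of_mem 𝒜 𝒜 _ (SetLike.coe_mem _),
    add_sub_cancel_right] at h1

/-- In a normal Noetherian domain, if `q ∣ a p` for all `p ∈ P` but `q ∤ a`, then `(a / q) P` is
not contained in `P`. -/
lemma exists_mul_eq_mul_not_mem [IsDomain R] [IsIntegrallyClosed R] [IsNoetherianRing R]
    {q a : R} {P : Ideal R} (hq : q ≠ 0) (hP : P ≠ ⊥) (ha : a ∈ colonIdeal (Ideal.span {q}) P)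
    (haq : a ∉ Ideal.span {q}) : ∃ p ∈ P, ∃ c, c ∉ P ∧ a * p = q * c := by
  by_contra! hcon
  let K := FractionRing R
  have hq' : algebraMap R K q ≠ 0 := by simpa using hq
  let N : Submodule R K := Submodule.map (Algebra.linearMap R K) P
  have hN : N ≠ ⊥ := by
    intro h0
    obtain ⟨p, hp, hp0⟩ := Submodule.exists_mem_ne_zero_of_ne_bot hP
    have : algebraMap R K p ∈ N := ⟨p, hp, rfl⟩
    rw [h0, Submodule.mem_bot] at this
    exact hp0 (by simpa using this)
  -- If the conclusion fails, multiplication by `a / q` maps the nonzero finitely generated module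
  -- `P` into itself. Then `a / q` is integral over `R`, hence in `R`, contradicting `q ∤ a`.
  have hint : IsIntegral R (algebraMap R K a / algebraMap R K q) := by
    refine isIntegral_of_smul_mem_submodule N hN ((IsNoetherian.noetherian P).map _) _ ?_
    rintro _ ⟨p, hp, rfl⟩
    obtain ⟨c, hc⟩ := Ideal.mem_span_singleton.1 (ha p hp)
    refine ⟨c, by_contra fun hcP => hcon p hp c hcP hc, ?_⟩
    rw [Algebra.linearMap_apply, Algebra.linearMap_apply, smul_eq_mul, div_mul_eq_mul_div,
      ← map_mul, hc, map_mul, mul_div_cancel_left₀ _ hq']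
  obtain ⟨y, hy⟩ := IsIntegrallyClosed.isIntegral_iff.1 hint
  refine haq (Ideal.mem_span_singleton'.2 ⟨y, ?_⟩)
  apply IsFractionRing.injective R K
  rw [map_mul, hy, div_mul_cancel₀ _ hq']

variable {𝒜} in
/-- The leading coefficient of `(qR : P) / qR` is at most that of `R / P`. -/
lemma HasPrimeExpansions.leading_colonIdeal_le [IsDomain R] [IsIntegrallyClosed R]
    [IsNoetherianRing R] {d : ℕ} (h : HasPrimeExpansions 𝒜 d) {q : R} {δ : ℝ} (hq0 : q ≠ 0)
    (hq : q ∈ 𝒜 δ) {P : Ideal R} (hP : P.IsPrime) (hPh : P.IsHomogeneous 𝒜) (hP0 : P ≠ ⊥)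
    {α β α' β' : ℝ}
    (h1 : HasExpansion d (fun x => hilb 𝒜 (colonIdeal (Ideal.span {q}) P) x -
      hilb 𝒜 (Ideal.span {q}) x) α β)
    (h2 : HasExpansion d (fun x => hilb 𝒜 (⊤ : Ideal R) x - hilb 𝒜 P x) α' β') : α ≤ α' := by
  classical
  have hA := h.finite
  have hqh := isHomogeneous_span_singleton 𝒜 hq
  have hXh := isHomogeneous_colonIdeal 𝒜 hqh hPh
  by_cases hX : colonIdeal (Ideal.span {q}) P ≤ Ideal.span {q}
  · refine h1.leading_le h2 fun x => ?_
    have h3 := hilb_mono_left 𝒜 hX hA x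
    have h4 := hilb_mono_left 𝒜 (le_top : P ≤ ⊤) hA x
    linarith
  · obtain ⟨b, hbX, hbq⟩ := SetLike.not_le_iff_exists.1 hX
    obtain ⟨e, he⟩ : ∃ t, (DirectSum.decompose 𝒜 b t : R) ∉ Ideal.span {q} := by
      by_contra! hcon
      exact hbq ((hqh.mem_iff 𝒜).2 hcon)
    obtain ⟨a, haX, haq, hae⟩ : ∃ a ∈ colonIdeal (Ideal.span {q}) P,
        a ∉ Ideal.span {q} ∧ a ∈ 𝒜 e := ⟨_, hXh e hbX, he, SetLike.coe_mem _⟩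
    obtain ⟨p, hp, c, hc, hpc⟩ := exists_mul_eq_mul_not_mem hq0 hP0 haX haq
    have hY := isHomogeneous_sup_span 𝒜 𝒜 hqh hae
    have hYX : Ideal.span {q} ⊔ Submodule.span R {a} ≤ colonIdeal (Ideal.span {q}) P :=
      sup_le (le_colonIdeal _ _) ((Submodule.span_singleton_le_iff_mem _ _).2 haX)
    -- From `a p = q c` and `x p = q y` follows `c x = y a`. So `(qR : P)` modulo `qR + aR` is
    -- killed by `P + cR`, strictly larger than `P`, and has leading coefficient `0`, while `(qR +
    -- aR) / qR` is a shifted quotient of `R / P`.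
    have hcX : ∀ x ∈ colonIdeal (Ideal.span {q}) P, c * x ∈ Submodule.span R {a} := by
      intro x hx
      obtain ⟨y, hy⟩ := Ideal.mem_span_singleton.1 (hx p hp)
      refine Submodule.mem_span_singleton.2 ⟨y, ?_⟩
      apply mul_left_cancel₀ hq0
      rw [smul_eq_mul]
      linear_combination x * hpc - a * hy
    -- Taking the submonoid `⊥` forces the leading coefficient of the whole quotient to vanish.
    obtain ⟨α₀, hα₀, β₀, h3⟩ := hasExpansion_of_primes 𝒜 𝒜 hA hA (d := d) ⊥ (P ⊔ Ideal.span {c})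
      (fun Q hQ hQh hle => by
        obtain ⟨β, h3⟩ := h.not_minimal P Q hP hQ hQh hP0 (lt_of_le_of_ne (le_sup_left.trans hle)
          fun heq => hc (heq ▸ (le_sup_right.trans hle) (Ideal.mem_span_singleton_self c)))
        exact ⟨0, AddSubmonoid.zero_mem _, β, h3⟩) hY hXh hYX (fun r hr x hx => by
        obtain ⟨r₁, hr₁, r₂, hr₂, rfl⟩ := Submodule.mem_sup.1 hr
        obtain ⟨r₃, rfl⟩ := Ideal.mem_span_singleton'.1 hr₂
        rw [add_smul, smul_eq_mul, smul_eq_mul, mul_assoc]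
        refine Submodule.add_mem _ (Submodule.mem_sup_left ?_)
          (Submodule.mem_sup_right (Submodule.smul_mem _ _ (hcX x hx)))
        rw [mul_comm]
        exact hx r₁ hr₁)
    obtain rfl : α₀ = 0 := AddSubmonoid.mem_bot.1 hα₀
    rw [← zero_add α']
    refine h1.leading_le (h3.add (h2.shift e)) fun x => ?_
    have h4 := hilb_sup_span 𝒜 𝒜 hqh hae hA hA x
    have h5 : P ≤ colonElem (Ideal.span {q}) a := fun r hr => by
      rw [mem_colonElem, smul_eq_mul, mul_comm]
      exact haX r hr
    have h6 := hilb_mono_left 𝒜 h5 hA (x - e)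
    linarith

/-! ### Functionals with values in a principal ideal -/

/-- The functionals that send `N` into the ideal `J`. -/
def dualInto (J : Ideal R) (N : Submodule R M) : Submodule R (Module.Dual R M) where
  carrier := {f | ∀ m ∈ N, f m ∈ J}
  add_mem' hf hg m hm := J.add_mem (hf m hm) (hg m hm)
  zero_mem' _ _ := J.zero_mem
  smul_mem' c _ hf m hm := J.mul_mem_left c (hf m hm)

lemma dualInto_anti (J : Ideal R) {N N' : Submodule R M} (h : N ≤ N') :
    dualInto J N' ≤ dualInto J N := fun _ hf m hm => hf m (h hm)

variable [DirectSum.Decomposition (dualGrading 𝒜 ℳ)]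

lemma decompose_dual_apply (l : ℝ) {t : ℝ} {m : M} (hm : m ∈ ℳ t) (f : Module.Dual R M) :
    (DirectSum.decompose (dualGrading 𝒜 ℳ) f l : Module.Dual R M) m =
      DirectSum.decompose 𝒜 (f m) (l + t) := by
  induction f using DirectSum.Decomposition.inductionOn (dualGrading 𝒜 ℳ) with
  | zero => simp
  | add f g hf hg =>
    simp only [DirectSum.decompose_add, DirectSum.add_apply, Submodule.coe_add,
      LinearMap.add_apply, hf, hg]
  | @homogeneous i f =>
    have h := f.2 t m hm
    by_cases hil : i = l
    · subst hil
      rw [DirectSum.decompose_of_mem_same _ f.2, DirectSum.decompose_of_mem_same 𝒜 h]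
    · rw [DirectSum.decompose_of_mem_ne _ f.2 hil,
        DirectSum.decompose_of_mem_ne 𝒜 h (fun h => hil (by linarith)), LinearMap.zero_apply]

lemma isHomogeneous_dualInto {J : Ideal R} (hJ : J.IsHomogeneous 𝒜) {N : Submodule R M}
    (hN : N.IsHomogeneous ℳ) : (dualInto J N).IsHomogeneous (dualGrading 𝒜 ℳ) := by
  classical
  intro l f hf m hm
  rw [← DirectSum.sum_support_decompose ℳ m, map_sum]
  refine J.sum_mem fun t _ => ?_
  rw [decompose_dual_apply 𝒜 ℳ l (SetLike.coe_mem _)]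
  exact hJ _ (hf _ (hN t hm))

/-- Evaluation at `m` embeds the quotient of the two modules of functionals into `(J : (N : m)) / J`
and raises degrees by `e`. It need not be surjective, hence only an inequality. -/
lemma hilb_dualInto_sub_le {J : Ideal R} {N : Submodule R M} {e : ℝ} {m : M} (hm : m ∈ ℳ e)
    (hA : ∀ x, FiniteDimensional k (gradedLE 𝒜 x))
    (hD : ∀ x, FiniteDimensional k (gradedLE (dualGrading 𝒜 ℳ) x)) (x : ℝ) :
    hilb (dualGrading 𝒜 ℳ) (dualInto J N) x -
      hilb (dualGrading 𝒜 ℳ) (dualInto J (N ⊔ Submodule.span R {m})) x ≤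
      hilb 𝒜 (colonIdeal J (colonElem N m)) (x + e) - hilb 𝒜 J (x + e) := by
  have := hA (x + e)
  have := hD x
  let T : Module.Dual R M →ₗ[k] R := (LinearMap.applyₗ m).restrictScalars k
  have hT : ∀ f, T f = f m := fun f => rfl
  have hfd1 : FiniteDimensional k (J.restrictScalars k ⊓ gradedLE 𝒜 (x + e) : Submodule k R) :=
    Submodule.finiteDimensional_of_le inf_le_right
  have hfd3 : FiniteDimensional k ((colonIdeal J (colonElem N m)).restrictScalars k ⊓
      gradedLE 𝒜 (x + e) : Submodule k R) :=
    Submodule.finiteDimensional_of_le inf_le_right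
  have hfd2 : FiniteDimensional k ((dualInto J N).restrictScalars k ⊓
      gradedLE (dualGrading 𝒜 ℳ) x : Submodule k (Module.Dual R M)) :=
    Submodule.finiteDimensional_of_le inf_le_right
  have key := finrank_map_sup_add_finrank_inf_comap T
    ((dualInto J N).restrictScalars k ⊓ gradedLE (dualGrading 𝒜 ℳ) x)
    (J.restrictScalars k ⊓ gradedLE 𝒜 (x + e))
  have hdeg : gradedLE (dualGrading 𝒜 ℳ) x ≤ (gradedLE 𝒜 (x + e)).comap T :=
    iSup₂_le fun t ht f hf => le_gradedLE 𝒜 (by linarith) (hf e m hm)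
  have h1 : ((dualInto J N).restrictScalars k ⊓ gradedLE (dualGrading 𝒜 ℳ) x) ⊓
      (J.restrictScalars k ⊓ gradedLE 𝒜 (x + e)).comap T =
      (dualInto J (N ⊔ Submodule.span R {m})).restrictScalars k ⊓
        gradedLE (dualGrading 𝒜 ℳ) x := by
    ext f
    constructor
    · rintro ⟨⟨hf, hfx⟩, hfJ, -⟩
      refine ⟨fun y hy => ?_, hfx⟩
      obtain ⟨n, hn, z, hz, rfl⟩ := Submodule.mem_sup.1 hy
      obtain ⟨r, rfl⟩ := Submodule.mem_span_singleton.1 hz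
      rw [map_add, map_smul]
      exact J.add_mem (hf n hn) (J.mul_mem_left r hfJ)
    · rintro ⟨hf, hfx⟩
      exact ⟨⟨dualInto_anti J le_sup_left hf, hfx⟩,
        hf m (Submodule.mem_sup_right (Submodule.mem_span_singleton_self m)), hdeg hfx⟩
  have h2 : ((dualInto J N).restrictScalars k ⊓ gradedLE (dualGrading 𝒜 ℳ) x).map T ⊔
      (J.restrictScalars k ⊓ gradedLE 𝒜 (x + e)) ≤
      (colonIdeal J (colonElem N m)).restrictScalars k ⊓ gradedLE 𝒜 (x + e) := by
    refine sup_le ?_ (inf_le_inf_right _ (le_colonIdeal J _))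
    rintro _ ⟨f, ⟨hf, hfx⟩, rfl⟩
    refine ⟨fun r hr => ?_, hdeg hfx⟩
    rw [hT, mul_comm, ← smul_eq_mul, ← map_smul]
    exact hf _ (mem_colonElem.1 hr)
  have h3 := Submodule.finrank_mono h2
  rw [h1] at key
  simp only [hilb]
  have key' : ((_ : ℕ) : ℝ) = _ := congrArg (Nat.cast : ℕ → ℝ) key
  have h3' : ((_ : ℕ) : ℝ) ≤ _ := Nat.cast_le (α := ℝ).2 h3
  push_cast at key'
  linarith

variable {𝒜} in
/-- The leading coefficient of `N^♯ / N'^♯`, where `N^♯` is the module of functionals that send `N`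
into `qR`, is at most that of `N' / N`. -/
lemma HasPrimeExpansions.leading_dualInto_le [IsDomain R] [IsIntegrallyClosed R]
    [IsNoetherianRing R] [Module.Finite R M] [Module.Finite R (Module.Dual R M)]
    {d : ℕ} (h : HasPrimeExpansions 𝒜 d) {q : R} {δ : ℝ} (hq0 : q ≠ 0) (hq : q ∈ 𝒜 δ)
    {s : R} (hs : s ≠ 0) {N N' : Submodule R M} (hN : N.IsHomogeneous ℳ)
    (hN' : N'.IsHomogeneous ℳ) (hle : N ≤ N') (hsN : ∀ m ∈ N', s • m ∈ N) {α β α' β' : ℝ}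
    (h1 : HasExpansion d (fun x => hilb ℳ N' x - hilb ℳ N x) α β)
    (h2 : HasExpansion d (fun x => hilb (dualGrading 𝒜 ℳ) (dualInto (Ideal.span {q}) N) x -
      hilb (dualGrading 𝒜 ℳ) (dualInto (Ideal.span {q}) N') x) α' β') : α' ≤ α := by
  have hA := h.finite
  have hM := finiteDimensional_gradedLE 𝒜 ℳ hA
  have hD := finiteDimensional_gradedLE 𝒜 (dualGrading 𝒜 ℳ) hA
  have hqh := isHomogeneous_span_singleton 𝒜 hq
  revert hsN α β α' β'
  refine homogeneous_induction ℳ 𝒜 hN' (C := fun N => (∀ m ∈ N', s • m ∈ N) →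
    ∀ {α β α' β' : ℝ},
    HasExpansion d (fun x => hilb ℳ N' x - hilb ℳ N x) α β →
    HasExpansion d (fun x => hilb (dualGrading 𝒜 ℳ) (dualInto (Ideal.span {q}) N) x -
      hilb (dualGrading 𝒜 ℳ) (dualInto (Ideal.span {q}) N') x) α' β' → α' ≤ α) ?_ ?_ N hle hN
  · intro _ α β α' β' h1 h2
    exact h2.leading_le h1 fun x => by simp
  -- With `P = (N : m)`, the step from `N` to `N + Rm` costs the leading coefficient `α₂` of `R / P`
  -- on one side and at most `α₄`, that of `(qR : P) / qR`, on the dual side. Normality gives `α₄ ≤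
  -- α₂`.
  · intro N hle hN e m hme hmN' hp ih hsN α β α' β' h1 h2
    have hN₁ := isHomogeneous_sup_span ℳ 𝒜 hN hme
    have hle₁ : N ⊔ Submodule.span R {m} ≤ N' :=
      sup_le hle ((Submodule.span_singleton_le_iff_mem _ _).2 hmN')
    have hsN₁ : ∀ m' ∈ N', s • m' ∈ N ⊔ Submodule.span R {m} :=
      fun m' hm' => Submodule.mem_sup_left (hsN m' hm')
    have hPh := isHomogeneous_colonElem 𝒜 ℳ hN hme
    have hsP : s ∈ colonElem N m := mem_colonElem.2 (hsN m hmN')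
    have hP0 : colonElem N m ≠ ⊥ := fun h0 => hs (by simpa [h0] using hsP)
    obtain ⟨α₁, β₁, h3⟩ := h.of_smul_mem ℳ hs hN₁ hN' hle₁ hsN₁
    obtain ⟨α₂, β₂, h4⟩ := h.ne_bot _ hp hPh hP0
    obtain ⟨α₃, β₃, h5⟩ := h.of_smul_mem (dualGrading 𝒜 ℳ) hs
      (isHomogeneous_dualInto 𝒜 ℳ hqh hN') (isHomogeneous_dualInto 𝒜 ℳ hqh hN₁)
      (dualInto_anti (Ideal.span {q}) hle₁) (fun f hf m' hm' => by
        rw [LinearMap.smul_apply, ← map_smul]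
        exact hf _ (hsN₁ m' hm'))
    obtain ⟨α₄, β₄, h6⟩ := h.of_smul_mem 𝒜 hs hqh (isHomogeneous_colonIdeal 𝒜 hqh hPh)
      (le_colonIdeal (Ideal.span {q}) (colonElem N m)) (fun a ha => by
        rw [smul_eq_mul, mul_comm]
        exact ha s hsP)
    have h7 : α₄ ≤ α₂ := h.leading_colonIdeal_le hq0 hq hp hPh hP0 h6 h4
    have h8 : α₃ ≤ α₁ := ih hsN₁ h3 h5
    have h9 : α₁ + α₂ ≤ α := (h3.add (h4.shift e)).leading_le h1 fun x => by
      rw [← hilb_sup_span 𝒜 ℳ hN hme hA hM]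
      linarith
    have h10 : α' ≤ α₄ + α₃ := h2.leading_le ((h6.shift (-e)).add h5) fun x => by
      have := hilb_dualInto_sub_le 𝒜 ℳ (J := Ideal.span {q}) (N := N) hme hA hD x
      rw [sub_neg_eq_add]
      linarith
    linarith

end Graded

/-! ### Free submodules and duality of degrees -/

section Graded

variable {k R M : Type*} [Field k] [CommRing R] [Algebra k R]
  [AddCommGroup M] [Module k M] [Module R M] [IsScalarTower k R M]
  (𝒜 : ℝ → Submodule k R) [GradedAlgebra 𝒜]
  (ℳ : ℝ → Submodule k M) [DirectSum.Decomposition ℳ] [SetLike.GradedSMul 𝒜 ℳ]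

lemma hilb_bot (x : ℝ) : hilb ℳ (⊥ : Submodule R M) x = 0 := by
  rw [hilb, Submodule.restrictScalars_bot, bot_inf_eq, finrank_bot, Nat.cast_zero]

lemma truncate_homogeneous_smul (x : ℝ) {e : ℝ} {s : R} (hs : s ∈ 𝒜 e) (m : M) :
    truncate ℳ x (s • m) = s • truncate ℳ (x - e) m := by
  induction m using DirectSum.Decomposition.inductionOn ℳ with
  | zero => simp
  | add m m' h h' => simp only [smul_add, map_add, h, h']
  | @homogeneous t m =>
    rw [truncate_of_mem ℳ x (smul_mem_add 𝒜 ℳ hs m.2), truncate_of_mem ℳ _ m.2]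
    simp only [le_sub_iff_add_le, add_comm e t]
    split_ifs <;> simp

lemma decompose_homogeneous_smul (t : ℝ) {e : ℝ} {s : R} (hs : s ∈ 𝒜 e) (m : M) :
    (DirectSum.decompose ℳ (s • m) t : M) = s • (DirectSum.decompose ℳ m (t - e) : M) := by
  induction m using DirectSum.Decomposition.inductionOn ℳ with
  | zero => simp
  | add m m' h h' =>
    simp only [smul_add, DirectSum.decompose_add, DirectSum.add_apply, Submodule.coe_add, h, h']
  | @homogeneous i m =>
    have h := smul_mem_add 𝒜 ℳ hs m.2
    by_cases hit : e + i = t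
    · subst hit
      rw [DirectSum.decompose_of_mem_same ℳ h, add_sub_cancel_left,
        DirectSum.decompose_of_mem_same ℳ m.2]
    · rw [DirectSum.decompose_of_mem_ne ℳ h hit,
        DirectSum.decompose_of_mem_ne ℳ m.2 (fun h => hit (by linarith)), smul_zero]

lemma isHomogeneous_range_lsmul {e : ℝ} {s : R} (hs : s ∈ 𝒜 e) :
    (LinearMap.range (LinearMap.lsmul R M s)).IsHomogeneous ℳ := by
  rintro t _ ⟨m, rfl⟩
  rw [LinearMap.lsmul_apply, decompose_homogeneous_smul 𝒜 ℳ t hs]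
  exact ⟨_, rfl⟩

lemma ker_lsmul_eq_bot [IsDomain R] [Module.IsTorsionFree R M] {s : R} (hs : s ≠ 0) :
    LinearMap.ker (LinearMap.lsmul R M s) = ⊥ := by
  rw [LinearMap.ker_eq_bot']
  intro m hm
  exact (smul_eq_zero.1 hm).resolve_left hs

/-- Multiplication by a homogeneous element shifts the Hilbert function. -/
lemma hilb_range_lsmul [IsDomain R] [Module.IsTorsionFree R M] {e : ℝ} {s : R} (hs : s ∈ 𝒜 e)
    (hs0 : s ≠ 0) (x : ℝ) :
    hilb ℳ (LinearMap.range (LinearMap.lsmul R M s)) x =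
      hilb ℳ (⊤ : Submodule R M) (x - e) := by
  let T : M →ₗ[k] M := (LinearMap.lsmul R M s).restrictScalars k
  have hT : Function.Injective T :=
    (LinearMap.ker_eq_bot.1 (ker_lsmul_eq_bot hs0) : Function.Injective (LinearMap.lsmul R M s))
  have h1 : (LinearMap.range (LinearMap.lsmul R M s)).restrictScalars k ⊓ gradedLE ℳ x =
      (gradedLE ℳ (x - e)).map T := by
    apply le_antisymm
    · rintro _ ⟨⟨m, rfl⟩, hm⟩
      refine ⟨truncate ℳ (x - e) m, truncate_mem_gradedLE ℳ _ m, ?_⟩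
      have := truncate_eq_self ℳ hm
      rw [LinearMap.lsmul_apply, truncate_homogeneous_smul 𝒜 ℳ x hs] at this
      exact this
    · rintro _ ⟨m, hm, rfl⟩
      refine ⟨⟨m, rfl⟩, ?_⟩
      change s • m ∈ gradedLE ℳ x
      rw [← truncate_eq_self ℳ hm, ← truncate_homogeneous_smul 𝒜 ℳ x hs]
      exact truncate_mem_gradedLE ℳ x _
  rw [hilb, h1, ← (Submodule.equivMapOfInjective T hT _).finrank_eq, hilb_top]
  rfl

lemma isHomogeneous_span_image (𝒜 : ℝ → Submodule k R) [GradedAlgebra 𝒜]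
    [SetLike.GradedSMul 𝒜 ℳ] {ι : Type*} {m : ι → M} {e : ι → ℝ} (hm : ∀ i, m i ∈ ℳ (e i))
    (T : Set ι) : (Submodule.span R (m '' T)).IsHomogeneous ℳ := by
  intro t y hy
  induction hy using Submodule.span_induction generalizing t with
  | mem y hy =>
    obtain ⟨i, hi, rfl⟩ := hy
    by_cases h : e i = t
    · subst h
      rw [DirectSum.decompose_of_mem_same ℳ (hm i)]
      exact Submodule.subset_span ⟨i, hi, rfl⟩
    · rw [DirectSum.decompose_of_mem_ne ℳ (hm i) h]
      exact zero_mem _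
  | zero => simp
  | add y z _ _ hy hz =>
    rw [DirectSum.decompose_add, DirectSum.add_apply, Submodule.coe_add]
    exact add_mem (hy t) (hz t)
  | smul r y _ hy =>
    induction r using DirectSum.Decomposition.inductionOn 𝒜 with
    | zero => simp
    | add r s hr hs =>
      rw [add_smul, DirectSum.decompose_add, DirectSum.add_apply, Submodule.coe_add]
      exact add_mem hr hs
    | @homogeneous i r =>
      rw [decompose_homogeneous_smul 𝒜 ℳ t r.2]
      exact Submodule.smul_mem _ _ (hy _)

/-- The Hilbert function of a submodule generated by linearly independent homogeneous elements. -/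
lemma hilb_span_of_linearIndependent {ι : Type*} [Fintype ι] {m : ι → M} {e : ι → ℝ}
    (hA : ∀ x, FiniteDimensional k (gradedLE 𝒜 x)) (hM : ∀ x, FiniteDimensional k (gradedLE ℳ x))
    (hm : ∀ i, m i ∈ ℳ (e i)) (hli : LinearIndependent R m) :
    hilb ℳ (Submodule.span R (range m)) =
      fun x => ∑ i, hilb 𝒜 (⊤ : Ideal R) (x - e i) := by
  classical
  have key : ∀ T : Finset ι, ∀ x, hilb ℳ (Submodule.span R (m '' T)) x =
      ∑ i ∈ T, hilb 𝒜 (⊤ : Ideal R) (x - e i) := by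
    intro T
    induction T using Finset.induction_on with
    | empty =>
      simp only [Finset.coe_empty, image_empty, Submodule.span_empty, Finset.sum_empty]
      exact hilb_bot ℳ
    | insert i T hi ih =>
      have hspan : Submodule.span R (m '' (insert i T : Finset ι)) =
          Submodule.span R (m '' T) ⊔ Submodule.span R {m i} := by
        rw [Finset.coe_insert, image_insert_eq, Submodule.span_insert, sup_comm]
      have hcolon : colonElem (Submodule.span R (m '' T)) (m i) = ⊥ := by
        rw [eq_bot_iff]
        intro r hr
        rw [mem_colonElem] at hr
        refine linearIndependent_iff_eq_zero_of_smul_mem_span.1 hli i r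
          (Submodule.span_mono (image_mono fun j hj => ?_) hr)
        exact ⟨trivial, fun h => hi (mem_singleton_iff.1 h ▸ hj)⟩
      rw [hspan]
      intro x
      have h1 := hilb_sup_span 𝒜 ℳ (isHomogeneous_span_image ℳ 𝒜 hm T) (hm i) hA hM x
      rw [hcolon, hilb_bot, ih] at h1
      rw [Finset.sum_insert hi]
      linarith
  have h := key Finset.univ
  rw [Finset.coe_univ, image_univ] at h
  exact funext h

lemma finrank_eq_card_of_smul_mem_span [IsDomain R] [Module.Finite R M] [IsNoetherianRing R]
    [Module.IsTorsionFree R M] {ι : Type*}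
    [Fintype ι] {m : ι → M} (hli : LinearIndependent R m) {s : R} (hs : s ≠ 0)
    (hsm : ∀ x, s • x ∈ Submodule.span R (range m)) : Module.finrank R M = Fintype.card ι := by
  apply le_antisymm
  · rw [← finrank_span_eq_card hli]
    refine LinearMap.finrank_le_finrank_of_injective
      (f := (LinearMap.lsmul R M s).codRestrict (Submodule.span R (range m)) hsm) ?_
    intro x y hxy
    exact LinearMap.ker_eq_bot.1 (ker_lsmul_eq_bot hs) (congrArg Subtype.val hxy)
  · exact hli.fintype_card_le_finrank

/-- A torsion-free module contains a free submodule with homogeneous basis that contains a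
homogeneous multiple of the module. -/
lemma exists_homogeneous_linearIndependent [IsDomain R] [Module.Finite R M] [IsNoetherianRing R] :
    ∃ (r : ℕ) (m : Fin r → M) (e : Fin r → ℝ), (∀ i, m i ∈ ℳ (e i)) ∧ LinearIndependent R m ∧
      ∃ (s : R) (δ : ℝ), s ≠ 0 ∧ s ∈ 𝒜 δ ∧ ∀ x, s • x ∈ Submodule.span R (range m) := by
  classical
  obtain ⟨S, d, hd, hS⟩ := exists_homogeneous_generators (R := R) ℳ
  -- Each homogeneous generator outside a maximal independent subset has a nonzero multiple in the
  -- span. Homogeneity of the colon ideal makes the multiplier homogeneous, and the product over all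
  -- generators works for `M`.
  obtain ⟨t, hli, hmax⟩ := exists_maximal_linearIndepOn R (fun g : S => (g : M))
  let E := Finite.equivFin t
  let m : Fin (Nat.card t) → M := fun i => ((E.symm i : S) : M)
  have hrange : range m = (fun g : S => (g : M)) '' t := by
    ext y
    constructor
    · rintro ⟨i, rfl⟩
      exact ⟨_, (E.symm i).2, rfl⟩
    · rintro ⟨g, hg, rfl⟩
      exact ⟨E ⟨g, hg⟩, by simp only [m, Equiv.symm_apply_apply]⟩
  have hm : ∀ i, m i ∈ ℳ (d (m i)) := fun i => hd _ (E.symm i : S).2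
  refine ⟨_, m, fun i => d (m i), hm, LinearIndependent.comp hli E.symm E.symm.injective, ?_⟩
  have hFh : (Submodule.span R (range m)).IsHomogeneous ℳ := by
    rw [← image_univ]
    exact isHomogeneous_span_image ℳ 𝒜 hm univ
  have hone : ∀ g ∈ S, ∃ (s : R) (δ : ℝ), s ≠ 0 ∧ s ∈ 𝒜 δ ∧
      s • g ∈ Submodule.span R (range m) := by
    intro g hg
    obtain ⟨a, ha, hag⟩ : ∃ a : R, a ≠ 0 ∧ a • g ∈ Submodule.span R (range m) := by
      rw [hrange]
      by_cases hgt : (⟨g, hg⟩ : S) ∈ t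
      · exact ⟨1, one_ne_zero, by rw [one_smul]; exact Submodule.subset_span ⟨_, hgt, rfl⟩⟩
      · exact hmax _ hgt
    obtain ⟨δ, hδ⟩ := exists_component_ne_zero 𝒜 ha
    exact ⟨_, δ, hδ, SetLike.coe_mem _, mem_colonElem.1
      (isHomogeneous_colonElem 𝒜 ℳ hFh (hd g hg) δ (mem_colonElem.2 hag))⟩
  have hall : ∀ T ⊆ S, ∃ (s : R) (δ : ℝ), s ≠ 0 ∧ s ∈ 𝒜 δ ∧
      ∀ g ∈ T, s • g ∈ Submodule.span R (range m) := by
    intro T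
    induction T using Finset.induction_on with
    | empty => exact fun _ => ⟨1, 0, one_ne_zero, SetLike.GradedOne.one_mem, by simp⟩
    | insert g T hg ih =>
      intro hT
      obtain ⟨s, δ, hs, hsδ, hsT⟩ := ih fun x hx => hT (Finset.mem_insert_of_mem hx)
      obtain ⟨s', δ', hs', hsδ', hsg⟩ := hone g (hT (Finset.mem_insert_self g T))
      refine ⟨s * s', δ + δ', mul_ne_zero hs hs', SetLike.mul_mem_graded hsδ hsδ',
        fun x hx => ?_⟩
      rcases Finset.mem_insert.1 hx with rfl | hx
      · rw [mul_smul]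
        exact Submodule.smul_mem _ _ hsg
      · rw [mul_comm, mul_smul]
        exact Submodule.smul_mem _ _ (hsT x hx)
  obtain ⟨s, δ, hs, hsδ, hsS⟩ := hall S subset_rfl
  refine ⟨s, δ, hs, hsδ, fun x => ?_⟩
  have hle : (⊤ : Submodule R M) ≤
      (Submodule.span R (range m)).comap (LinearMap.lsmul R M s) := by
    rw [← hS, Submodule.span_le]
    exact hsS
  exact hle Submodule.mem_top

lemma eq_of_sum_smul_eq {ι : Type*} [Fintype ι] {m : ι → M} (hli : LinearIndependent R m)
    {c c' : ι → R} (h : ∑ i, c i • m i = ∑ i, c' i • m i) : c = c' := by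
  ext i
  refine sub_eq_zero.1 (Fintype.linearIndependent_iff.1 hli (fun i => c i - c' i) ?_ i)
  simp only [sub_smul, Finset.sum_sub_distrib, h, sub_self]

/-- The functionals that are `s` times the dual basis of linearly independent elements whose span
contains `s M`. -/
lemma exists_dual_family {ι : Type*} [Fintype ι] [DecidableEq ι] {m : ι → M} {e : ι → ℝ}
    (hm : ∀ i, m i ∈ ℳ (e i)) (hli : LinearIndependent R m) {s : R} {δ : ℝ} (hs : s ∈ 𝒜 δ)
    (hsm : ∀ x, s • x ∈ Submodule.span R (range m)) :
    ∃ f : ι → Module.Dual R M, (∀ i, f i ∈ dualGrading 𝒜 ℳ (δ - e i)) ∧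
      (∀ i j, f i (m j) = if i = j then s else 0) ∧ ∀ x, s • x = ∑ i, f i x • m i := by
  let b := Module.Basis.span hli
  let mulS : M →ₗ[R] Submodule.span R (range m) := (LinearMap.lsmul R M s).codRestrict _ hsm
  have hsum : ∀ x, s • x = ∑ i, b.repr (mulS x) i • m i := by
    intro x
    have := congrArg Subtype.val (b.sum_repr (mulS x))
    rw [AddSubmonoidClass.coe_finsetSum] at this
    simp only [Submodule.coe_smul] at this
    refine Eq.trans ?_ (this.symm.trans (Finset.sum_congr rfl fun i _ => ?_))
    · rfl
    · rw [Module.Basis.span_apply]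
  refine ⟨fun i => b.coord i ∘ₗ mulS, fun i t x hx => ?_, fun i j => ?_, hsum⟩
  -- Coordinates in a basis are unique, so those of a homogeneous element equal their own components
  -- of the expected degree.
  · have h1 : ∑ i, b.repr (mulS x) i • m i =
        ∑ i, (DirectSum.decompose 𝒜 (b.repr (mulS x) i) (δ + t - e i) : R) • m i := by
      have h2 := DirectSum.decompose_of_mem_same ℳ (smul_mem_add 𝒜 ℳ hs hx)
      rw [hsum x, DirectSum.decompose_sum, DFinsupp.finsetSum_apply,
        AddSubmonoidClass.coe_finsetSum] at h2
      rw [← h2]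
      exact Finset.sum_congr rfl fun i _ => decompose_smul_of_mem 𝒜 ℳ _ (hm i) _
    have h3 := congrFun (eq_of_sum_smul_eq hli h1) i
    have h4 : b.repr (mulS x) i ∈ 𝒜 (δ + t - e i) := by
      rw [h3]
      exact SetLike.coe_mem _
    rw [show δ - e i + t = δ + t - e i by ring]
    exact h4
  · have h1 : ∑ i, b.repr (mulS (m j)) i • m i = ∑ i, (if i = j then s else 0) • m i := by
      rw [← hsum (m j)]
      simp [ite_smul]
    exact congrFun (eq_of_sum_smul_eq hli h1) i

end Graded

section Graded

variable {k R M : Type*} [Field k] [CommRing R] [Algebra k R]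
  [AddCommGroup M] [Module k M] [Module R M] [IsScalarTower k R M]
  (𝒜 : ℝ → Submodule k R) [GradedAlgebra 𝒜]
  (ℳ : ℝ → Submodule k M) [DirectSum.Decomposition ℳ] [SetLike.GradedSMul 𝒜 ℳ]

/-! ### Free modules of functionals and the duals of `sF`, `F` and `sM` -/

section DualFamily

variable [IsDomain R] {ι : Type*} [Fintype ι] [DecidableEq ι] {m : ι → M}
  {f : ι → Module.Dual R M} {s : R}

lemma linearIndependent_dual_family (hs : s ≠ 0)
    (hfm : ∀ i j, f i (m j) = if i = j then s else 0) : LinearIndependent R f := by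
  refine Fintype.linearIndependent_iff.2 fun c hc j => ?_
  have := LinearMap.congr_fun hc (m j)
  rw [LinearMap.sum_apply] at this
  simp only [LinearMap.smul_apply, hfm, smul_eq_mul, mul_ite, mul_zero, LinearMap.zero_apply,
    Finset.sum_ite_eq', Finset.mem_univ, if_true] at this
  exact (mul_eq_zero.1 this).resolve_right hs

lemma linearIndependent_const_smul [Module.IsTorsionFree R M] (hs : s ≠ 0)
    (hli : LinearIndependent R m) : LinearIndependent R fun i => s • m i :=
  hli.map' (LinearMap.lsmul R M s) (ker_lsmul_eq_bot hs)

/-- Both sides agree after multiplication by `s`, because `s • x` is a combination of the `m i` with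
coefficients `f i x`. -/
lemma eq_sum_of_apply_eq_mul (hs : s ≠ 0) (hsum : ∀ x, s • x = ∑ i, f i x • m i)
    {g : Module.Dual R M} {c : ι → R} (hc : ∀ i, g (m i) = s * c i) : g = ∑ i, c i • f i := by
  ext x
  apply mul_left_cancel₀ hs
  rw [← smul_eq_mul, ← map_smul, hsum x, map_sum, LinearMap.sum_apply, Finset.mul_sum]
  refine Finset.sum_congr rfl fun i _ => ?_
  rw [map_smul, hc, LinearMap.smul_apply, smul_eq_mul, smul_eq_mul]
  ring

lemma dualInto_span_smul (hs : s ≠ 0) (hfm : ∀ i j, f i (m j) = if i = j then s else 0)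
    (hsum : ∀ x, s • x = ∑ i, f i x • m i) :
    dualInto (Ideal.span {s * s}) (Submodule.span R (range fun i => s • m i)) =
      Submodule.span R (range f) := by
  apply le_antisymm
  · intro g hg
    have h1 : ∀ i, ∃ c, g (m i) = s * c := fun i => by
      obtain ⟨c, hc⟩ := Ideal.mem_span_singleton.1 (hg _ (Submodule.subset_span ⟨i, rfl⟩))
      refine ⟨c, mul_left_cancel₀ hs ?_⟩
      rw [← smul_eq_mul, ← map_smul, hc]
      ring
    choose c hc using h1
    rw [eq_sum_of_apply_eq_mul hs hsum hc]
    exact Submodule.sum_mem _ fun i _ => Submodule.smul_mem _ _ (Submodule.subset_span ⟨i, rfl⟩)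
  · rw [Submodule.span_le]
    rintro _ ⟨i, rfl⟩
    have hle : Submodule.span R (range fun i => s • m i) ≤
        Submodule.comap (f i) (Ideal.span {s * s}) := by
      rw [Submodule.span_le]
      rintro _ ⟨j, rfl⟩
      refine Ideal.mem_span_singleton.2 ?_
      rw [map_smul, hfm, smul_eq_mul]
      split_ifs
      · exact dvd_rfl
      · simp
    exact hle

lemma dualInto_span (hs : s ≠ 0) (hfm : ∀ i j, f i (m j) = if i = j then s else 0)
    (hsum : ∀ x, s • x = ∑ i, f i x • m i) :
    dualInto (Ideal.span {s * s}) (Submodule.span R (range m)) =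
      Submodule.span R (range fun i => s • f i) := by
  apply le_antisymm
  · intro g hg
    have h1 : ∀ i, ∃ c, g (m i) = s * (s * c) := fun i => by
      obtain ⟨c, hc⟩ := Ideal.mem_span_singleton.1 (hg _ (Submodule.subset_span ⟨i, rfl⟩))
      exact ⟨c, by rw [hc, mul_assoc]⟩
    choose c hc using h1
    rw [eq_sum_of_apply_eq_mul hs hsum hc]
    refine Submodule.sum_mem _ fun i _ => ?_
    rw [mul_comm, mul_smul]
    exact Submodule.smul_mem _ _ (Submodule.subset_span ⟨i, rfl⟩)
  · rw [Submodule.span_le]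
    rintro _ ⟨i, rfl⟩
    have hle : Submodule.span R (range m) ≤
        Submodule.comap (s • f i) (Ideal.span {s * s}) := by
      rw [Submodule.span_le]
      rintro _ ⟨j, rfl⟩
      refine Ideal.mem_span_singleton.2 ?_
      rw [LinearMap.smul_apply, hfm, smul_eq_mul]
      split_ifs
      · exact dvd_rfl
      · simp
    exact hle

lemma dualInto_range_lsmul (hs : s ≠ 0) :
    dualInto (Ideal.span {s * s}) (LinearMap.range (LinearMap.lsmul R M s)) =
      LinearMap.range (LinearMap.lsmul R (Module.Dual R M) s) := by
  apply le_antisymm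
  · intro g hg
    have h1 : ∀ x, ∃ c, g x = s * c := fun x => by
      obtain ⟨c, hc⟩ := Ideal.mem_span_singleton.1 (hg _ ⟨x, rfl⟩)
      refine ⟨c, mul_left_cancel₀ hs ?_⟩
      rw [← smul_eq_mul, ← map_smul, ← LinearMap.lsmul_apply, hc]
      ring
    choose c hc using h1
    refine ⟨{ toFun := c, map_add' := fun x y => ?_, map_smul' := fun r x => ?_ }, ?_⟩
    · apply mul_left_cancel₀ hs
      rw [mul_add, ← hc, ← hc, ← hc, map_add]
    · apply mul_left_cancel₀ hs
      rw [← hc, map_smul, hc, smul_eq_mul, smul_eq_mul, RingHom.id_apply]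
      ring
    · ext x
      exact (hc x).symm
  · rintro _ ⟨g, rfl⟩ _ ⟨x, rfl⟩
    refine Ideal.mem_span_singleton.2 ⟨g x, ?_⟩
    simp only [LinearMap.lsmul_apply, LinearMap.smul_apply, map_smul, smul_eq_mul]
    ring

end DualFamily

variable {𝒜} in
/-- The quotient of a free graded module by the multiples of a homogeneous element `s` has leading
coefficient `r` times that of `R / sR`. -/
lemma HasExpansion.leading_free_quotient {d r : ℕ} {δ κ β α β' : ℝ} {h : ℝ → ℝ} {e : Fin r → ℝ}
    (h1 : HasExpansion d (fun x => h x - h (x - δ)) κ β)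
    (h2 : HasExpansion d (fun x => ∑ i, h (x - e i) - ∑ i, h (x - (δ + e i))) α β') :
    α = r * κ := by
  have h3 := HasExpansion.sum (t := Finset.univ) fun (i : Fin r) _ => h1.shift (e i)
  have h4 : (fun x => ∑ i, h (x - e i) - ∑ i, h (x - (δ + e i))) =
      fun x => ∑ i, (h (x - e i) - h (x - e i - δ)) := by
    ext x
    rw [← Finset.sum_sub_distrib]
    refine Finset.sum_congr rfl fun i _ => ?_
    rw [sub_sub, add_comm]
  rw [h4] at h2
  rw [h2.leading_unique h3]
  simp

variable [DirectSum.Decomposition (dualGrading 𝒜 ℳ)]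

variable {𝒜} in
/-- The second coefficients of the expansions of the Hilbert functions of a torsion-free module and
of its dual add up to `2 rank(M)` times that of `R`. -/
theorem HasPrimeExpansions.hilb_add_hilb_dual [IsDomain R] [IsIntegrallyClosed R]
    [IsNoetherianRing R] [Module.Finite R M] [Module.IsTorsionFree R M]
    {d : ℕ} (h : HasPrimeExpansions 𝒜 d) {A B : ℝ}
    (hAB : HasExpansion (d + 1) (hilb 𝒜 (⊤ : Ideal R)) A B) :
    Module.finrank R (Module.Dual R M) = Module.finrank R M ∧ ∃ α β α' β' : ℝ,
      HasExpansion (d + 1) (hilb ℳ (⊤ : Submodule R M)) α β ∧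
      HasExpansion (d + 1) (hilb (dualGrading 𝒜 ℳ) (⊤ : Submodule R (Module.Dual R M))) α' β' ∧
      β + β' = 2 * Module.finrank R M * B := by
  classical
  have hA := h.finite
  have hM := finiteDimensional_gradedLE 𝒜 ℳ hA
  have hD := finiteDimensional_gradedLE 𝒜 (dualGrading 𝒜 ℳ) hA
  obtain ⟨r, m, e, hm, hli, s, δ, hs0, hs, hsm⟩ := exists_homogeneous_linearIndependent 𝒜 ℳ
  obtain ⟨f, hf, hfm, hsum⟩ := exists_dual_family 𝒜 ℳ hm hli hs hsm
  have hfli := linearIndependent_dual_family hs0 hfm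
  have hrank : Module.finrank R M = r := by
    rw [finrank_eq_card_of_smul_mem_span hli hs0 hsm, Fintype.card_fin]
  have hrank' : Module.finrank R (Module.Dual R M) = r := by
    rw [finrank_eq_card_of_smul_mem_span hfli hs0, Fintype.card_fin]
    intro g
    -- The multiple `s g` is the combination of the `f i` with coefficients `g (m i)`, so the dual
    -- also has rank `r`.
    rw [eq_sum_of_apply_eq_mul (g := s • g) (c := fun i => g (m i)) hs0 hsum fun i => rfl]
    exact Submodule.sum_mem _ fun i _ => Submodule.smul_mem _ _ (Submodule.subset_span ⟨i, rfl⟩)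
  refine ⟨hrank'.trans hrank.symm, ?_⟩
  rw [hrank]
  -- the submodules `sF ≤ sM ≤ F` and their duals
  have hqd : s * s ∈ 𝒜 (δ + δ) := SetLike.mul_mem_graded hs hs
  have hq0 : s * s ≠ 0 := mul_ne_zero hs0 hs0
  have hsmd : ∀ i, s • m i ∈ ℳ (δ + e i) := fun i => smul_mem_add 𝒜 ℳ hs (hm i)
  have hsfd : ∀ i, s • f i ∈ dualGrading 𝒜 ℳ (δ + (δ - e i)) :=
    fun i => smul_mem_add 𝒜 (dualGrading 𝒜 ℳ) hs (hf i)
  set F : Submodule R M := Submodule.span R (range m) with hF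
  set F' : Submodule R M := Submodule.span R (range fun i => s • m i) with hF'
  set M' : Submodule R M := LinearMap.range (LinearMap.lsmul R M s) with hM'
  have hFh : F.IsHomogeneous ℳ := by
    rw [hF, ← image_univ]
    exact isHomogeneous_span_image ℳ 𝒜 hm univ
  have hFh' : F'.IsHomogeneous ℳ := by
    rw [hF', ← image_univ]
    exact isHomogeneous_span_image ℳ 𝒜 hsmd univ
  have hMh' : M'.IsHomogeneous ℳ := isHomogeneous_range_lsmul 𝒜 ℳ hs
  have hFM : F' ≤ M' := by
    rw [hF', Submodule.span_le]
    rintro _ ⟨i, rfl⟩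
    exact ⟨m i, rfl⟩
  have hMF : M' ≤ F := by
    rintro _ ⟨x, rfl⟩
    exact hsm x
  have hsMF : ∀ x ∈ M', s • x ∈ F' := by
    rintro _ ⟨x, rfl⟩
    rw [LinearMap.lsmul_apply, hsum x, Finset.smul_sum]
    refine Submodule.sum_mem _ fun i _ => ?_
    rw [smul_comm]
    exact Submodule.smul_mem _ _ (Submodule.subset_span ⟨i, rfl⟩)
  have hsFM : ∀ x ∈ F, s • x ∈ M' := fun x _ => ⟨x, rfl⟩
  have hsD : ∀ N N' : Submodule R M, (∀ x ∈ N', s • x ∈ N) →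
      ∀ g ∈ dualInto (Ideal.span {s * s}) N, s • g ∈ dualInto (Ideal.span {s * s}) N' := by
    intro N N' hNN g hg x hx
    rw [LinearMap.smul_apply, ← map_smul]
    exact hg _ (hNN x hx)
  have hJh := isHomogeneous_span_singleton 𝒜 hqd
  -- leading coefficients of the quotients
  obtain ⟨α₁, β₁, h1⟩ := h.of_smul_mem ℳ hs0 hFh' hMh' hFM hsMF
  obtain ⟨α₂, β₂, h2⟩ := h.of_smul_mem ℳ hs0 hMh' hFh hMF hsFM
  obtain ⟨α₁', β₁', h1'⟩ := h.of_smul_mem (dualGrading 𝒜 ℳ) hs0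
    (isHomogeneous_dualInto 𝒜 ℳ hJh hMh') (isHomogeneous_dualInto 𝒜 ℳ hJh hFh')
    (dualInto_anti _ hFM) (hsD _ _ hsMF)
  obtain ⟨α₂', β₂', h2'⟩ := h.of_smul_mem (dualGrading 𝒜 ℳ) hs0
    (isHomogeneous_dualInto 𝒜 ℳ hJh hFh) (isHomogeneous_dualInto 𝒜 ℳ hJh hMh')
    (dualInto_anti _ hMF) (hsD _ _ hsFM)
  have hle₁ : α₁' ≤ α₁ :=
    h.leading_dualInto_le ℳ hq0 hqd hs0 hFh' hMh' hFM hsMF h1 h1'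
  have hle₂ : α₂' ≤ α₂ :=
    h.leading_dualInto_le ℳ hq0 hqd hs0 hMh' hFh hMF hsFM h2 h2'
  -- Hilbert functions
  have eF : ∀ x, hilb ℳ F x = ∑ i, hilb 𝒜 (⊤ : Ideal R) (x - e i) :=
    congrFun (hilb_span_of_linearIndependent 𝒜 ℳ hA hM hm hli)
  have eF' : ∀ x, hilb ℳ F' x = ∑ i, hilb 𝒜 (⊤ : Ideal R) (x - (δ + e i)) :=
    congrFun (hilb_span_of_linearIndependent 𝒜 ℳ hA hM hsmd (linearIndependent_const_smul hs0 hli))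
  have eM' : ∀ x, hilb ℳ M' x = hilb ℳ (⊤ : Submodule R M) (x - δ) :=
    hilb_range_lsmul 𝒜 ℳ hs hs0
  have eG' : ∀ x, hilb (dualGrading 𝒜 ℳ) (dualInto (Ideal.span {s * s}) F') x =
      ∑ i, hilb 𝒜 (⊤ : Ideal R) (x - (δ - e i)) := by
    rw [dualInto_span_smul hs0 hfm hsum]
    exact congrFun (hilb_span_of_linearIndependent 𝒜 (dualGrading 𝒜 ℳ) hA hD hf hfli)
  have eG : ∀ x, hilb (dualGrading 𝒜 ℳ) (dualInto (Ideal.span {s * s}) F) x =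
      ∑ i, hilb 𝒜 (⊤ : Ideal R) (x - (δ + (δ - e i))) := by
    rw [dualInto_span hs0 hfm hsum]
    exact congrFun (hilb_span_of_linearIndependent 𝒜 (dualGrading 𝒜 ℳ) hA hD hsfd
      (linearIndependent_const_smul hs0 hfli))
  have eD : ∀ x, hilb (dualGrading 𝒜 ℳ) (dualInto (Ideal.span {s * s}) M') x =
      hilb (dualGrading 𝒜 ℳ) (⊤ : Submodule R (Module.Dual R M)) (x - δ) := by
    rw [dualInto_range_lsmul hs0]
    exact hilb_range_lsmul 𝒜 (dualGrading 𝒜 ℳ) hs hs0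
  -- comparison of the total leading coefficients
  obtain ⟨κ, βκ, hκ⟩ := h.of_smul_mem 𝒜 hs0 (isHomogeneous_span_singleton 𝒜 hs)
    (isHomogeneous_top 𝒜) le_top (fun x _ => Ideal.mul_mem_right x _
      (Ideal.mem_span_singleton_self s))
  have hκ' : HasExpansion d (fun x => hilb 𝒜 (⊤ : Ideal R) x - hilb 𝒜 (⊤ : Ideal R) (x - δ))
      κ βκ := by
    have hcolon : colonElem (⊥ : Ideal R) s = ⊥ := by
      ext x
      simp [hs0]
    convert! hκ using 2 with x
    have h3 := hilb_sup_span 𝒜 𝒜 (isHomogeneous_bot (R := R) 𝒜) hs hA hA x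
    rw [hcolon, hilb_bot, hilb_bot, bot_sup_eq, sub_zero, sub_zero] at h3
    rw [Ideal.span, h3]
  -- `F / sF` is a sum of `r` shifts of `R / sR`, and so is `(sF)^♯ / F^♯` below; leading
  -- coefficients ignore the shifts.
  have htot : α₁ + α₂ = r * κ := by
    refine hκ'.leading_free_quotient (e := e) (β' := β₁ + β₂) ?_
    convert! h1.add h2 using 2 with x
    rw [← eF, ← eF']
    ring
  have htot' : α₁' + α₂' = r * κ := by
    refine hκ'.leading_free_quotient (e := fun i => δ - e i) (β' := β₁' + β₂') ?_
    convert! h1'.add h2' using 2 with x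
    rw [← eG, ← eG']
    ring
  have heq : α₁' = α₁ := by linarith
  -- `sM` is `sF` plus the torsion part, `(sM)^♯` is `(sF)^♯` minus its torsion part; the final
  -- shift by `-δ` undoes multiplication by `s`. In the sum of second coefficients the torsion
  -- terms, the `e i` and the `δ` all cancel.
  have hexp := ((HasExpansion.sum (t := Finset.univ)
    fun (i : Fin r) _ => hAB.shift (δ + e i)).add h1.raise).shift (-δ)
  have hexp' := ((HasExpansion.sum (t := Finset.univ)
    fun (i : Fin r) _ => hAB.shift (δ - e i)).sub h1'.raise).shift (-δ)
  refine ⟨_, _, _, _, by simpa only [← eF', eM', sub_neg_eq_add, add_sub_cancel_right,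
      add_sub_cancel] using hexp, by simpa only [← eG', eD, sub_neg_eq_add, add_sub_cancel_right,
      sub_sub_cancel] using hexp', ?_⟩
  rw [heq]
  simp only [Finset.sum_sub_distrib, Finset.sum_const, Finset.card_univ, Fintype.card_fin,
    nsmul_eq_mul, add_mul, sub_mul, Finset.sum_add_distrib]
  ring

end Graded

/-! ### Conclusion -/

lemma subCoeff_eq {k M : Type*} [Field k] [AddCommGroup M] [Module k M] {n : ℕ} (hn : 1 ≤ n)
    {ℳ : ℝ → Submodule k M} {a b : ℝ} (h : IsRRCoeffs n ℳ a b) : subCoeff n ℳ = b := by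
  have hex : ∃ b a : ℝ, IsRRCoeffs n ℳ a b := ⟨b, a, h⟩
  rw [subCoeff, dif_pos hex]
  obtain ⟨a', h'⟩ := hex.choose_spec
  exact (h'.unique hn h).2

end

theorem mainTheorem7 {k R M : Type*} [Field k] [IsAlgClosed k]
    [CommRing R] [IsDomain R] [IsIntegrallyClosed R] [Algebra k R] [Algebra.FiniteType k R]
    (𝒜 : ℝ → Submodule k R) [GradedAlgebra 𝒜]
    (hneg : ∀ t < 0, 𝒜 t = ⊥)
    (hzero : ∀ r ∈ 𝒜 0, ∃ c : k, algebraMap k R c = r)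
    (n : ℕ) (hn : ringKrullDim R = n) (hn1 : 1 ≤ n)
    [AddCommGroup M] [Module k M] [Module R M] [IsScalarTower k R M]
    [Module.Finite R M] [Module.IsTorsionFree R M]
    (ℳ : ℝ → Submodule k M) [DirectSum.Decomposition ℳ] [SetLike.GradedSMul 𝒜 ℳ] :
    (HasRRCoeffs n 𝒜 ∧ HasRRCoeffs n ℳ ∧ HasRRCoeffs n (dualGrading 𝒜 ℳ)) ∧
      gradedDegree n 𝒜 (dualGrading 𝒜 ℳ) = -gradedDegree n 𝒜 ℳ := by
  classical
  obtain ⟨d, rfl⟩ : ∃ d, n = d + 1 := ⟨n - 1, by omega⟩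
  have : IsNoetherianRing R := Algebra.FiniteType.isNoetherianRing k R
  let _ : DirectSum.Decomposition (dualGrading 𝒜 ℳ) :=
    (dualGrading_isInternal 𝒜 ℳ).chooseDecomposition
  have h := hasPrimeExpansions 𝒜 hneg hzero hn
  have hA := h.finite
  have hM := finiteDimensional_gradedLE 𝒜 ℳ hA
  have hD := finiteDimensional_gradedLE 𝒜 (dualGrading 𝒜 ℳ) hA
  obtain ⟨A, B, hAB⟩ : ∃ A B, HasExpansion (d + 1) (hilb 𝒜 (⊤ : Ideal R)) A B := by
    obtain ⟨A, B, hAB⟩ := hasExpansion_of_coheight_le 𝒜 hneg hzero hA (d + 1) ⊥ Ideal.isPrime_bot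
      (isHomogeneous_bot (R := R) 𝒜) (by
        have h1 := Order.coheight_le_krullDim (⟨⊥, Ideal.isPrime_bot⟩ : PrimeSpectrum R)
        have h2 : ((Order.coheight (⟨⊥, Ideal.isPrime_bot⟩ : PrimeSpectrum R) : ℕ∞) :
            WithBot ℕ∞) ≤ ((d + 1 : ℕ) : WithBot ℕ∞) := hn ▸ h1
        exact WithBot.coe_le_coe.1 h2)
    exact ⟨A, B, by simpa only [hilb_bot, sub_zero] using hAB⟩
  obtain ⟨hrank, α, β, α', β', h1, h2, hsum⟩ := h.hilb_add_hilb_dual ℳ hAB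
  rw [hilb_top] at hAB h1 h2
  have hR := IsRRCoeffs.of_hasExpansion hn1 hA hAB
  have hM' := IsRRCoeffs.of_hasExpansion hn1 hM h1
  have hD' := IsRRCoeffs.of_hasExpansion hn1 hD h2
  refine ⟨⟨⟨_, _, hR⟩, ⟨_, _, hM'⟩, ⟨_, _, hD'⟩⟩, ?_⟩
  rw [gradedDegree, gradedDegree, subCoeff_eq hn1 hR, subCoeff_eq hn1 hM', subCoeff_eq hn1 hD',
    hrank]
  -- Each second coefficient is `n!` times the one in the expansion, and both ranks agree, so `deg M
  -- + deg M^∨` is `n!` times `β + β' - 2 rank(M) B`.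
  linear_combination ((d + 1) ! : ℝ) * hsum
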